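/- Let $E=(E^0,E^1,r,s)$ be a finite directed graph without sources and without sinks, and let $n,k\ge 1$. Paths of $E$ are written $w=e_1e_2\cdots e_m$ with $s(e_i)=r(e_{i+1})$, so that $s(w)=s(e_m)$ and $r(w)=r(e_1)$; vertices are the paths of length $0$, and $E^*$ is the set of all finite paths. For $w\in E^*$ and $N\ge 1$ write $w=w(N)\,v$ with $|w(N)|<N$ and $N$ dividing $|v|$. Let $E(N)$ be the finite graph whose vertices are the paths of $E$ of length $<N$ and whose edges are the pairs $(e,w)$ with $e\in E^1$, $|w|<N$ and $s(e)=r(w)$, where $s(e,w)=w$, and $r(e,w)=ew$ if $|w|<N-1$, $r(e,w)=r(e)$ if $|w|=N-1$. For a finite graph $F$ let $\mathcal O(F)$ be the universal C*-algebra generated by a Cuntz–Krieger $F$-family $\{P_x,S_f\}$. On $\ell^2(E^*)$, with orthonormal basis $(\xi_w)$, a weighted shift with weights $\lambda$ is a family of bounded operators $(T_e)_{e\in E^1}$ such that $T_e\xi_w=\lambda(ew)\xi_{ew}$ if $s(e)=r(w)$ and $T_e\xi_w=0$ otherwise. It has period $N$ if $\lambda(ew)=\lambda(e\,w(N))$ whenever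 $s(e)=r(w)$. Let $\mathcal A(N)$ be the C*-algebra generated by the operators of all weighted shifts of period $N$. Let $\mathfrak K_E=\bigoplus_{x\in E^0}R_x\mathfrak K R_x$, where $\mathfrak K$ is the set of compact operators and $R_x$ is the projection onto the closed span of the $\xi_w$ with $s(w)=x$, and put $\mathcal B(N)=\mathcal A(N)/\mathfrak K_E$. Then $\mathcal A(n)\subseteq\mathcal A(nk)$, which induces $\bar i:\mathcal B(n)\to\mathcal B(nk)$. A factor map $F\to G$ of finite graphs is a pair of maps $m^0:F^0\to G^0$, $m^1:F^1\to G^1$ which commutes with the range and source maps and is such that for all $g\in G^1$, $v\in F^0$ with $s(g)=m^0(v)$ there is a unique $f\in F^1$ with $m^1(f)=g$ and $s(f)=v$. It is regular if $r^{-1}(v)\neq\emptyset$ whenever $v\in F^0$ and $r^{-1}(m^0(v))\ne\emptyset$. Then the following hold. 1. $m^0(w)=w(n)$ and $m^1(e,w)=(e,w(n))$ define a regular factor map $m:E(nk)\to E(n)$. 2. For $N=n$ and for $N=nk$ there is a unique $*$-isomorphism $\pi_N:\mathcal O(E(N))\to\mathcal B(N)$ which sends $P_w$ to the class of the projection $Q_w$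 given by $Q_w\xi_{w'}=\xi_{w'}$ if $w'(N)=w$ and $Q_w\xi_{w'}=0$ otherwise, and sends $S_{(e,w)}$ to the class of the operator $T_{(e,w)}$ given by $T_{(e,w)}\xi_{w'}=\xi_{ew'}$ if $w'(N)=w$ and $T_{(e,w)}\xi_{w'}=0$ otherwise. These operators lie in $\mathcal A(N)$. 3. There is a unique $*$-homomorphism $\mu_m:\mathcal O(E(n))\to\mathcal O(E(nk))$ such that $\mu_m(P_v)=\sum_{m^0(u)=v}P_u$ for every vertex $v$ and $\mu_m(S_e)=\sum_{m^1(f)=e}S_f$ for every edge $e$ of $E(n)$. 4. The connecting map $j_{nk,n}=\pi_{nk}^{-1}\circ\bar i\circ\pi_n:\mathcal O(E(n))\to\mathcal O(E(nk))$ is injective, and $j_{nk,n}=\mu_m$. -/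

import Mathlib

open scoped ENNReal

universe u

noncomputable section

namespace GraphAlg

/-! ## Finite directed graphs and paths -/

/-- A finite directed graph `(E⁰, E¹, r, s)`. -/
structure FiniteGraph : Type (u + 1) where
  Vertex : Type u
  Edge : Type u
  r : Edge → Vertex
  s : Edge → Vertex
  finite_vertex : Finite Vertex
  finite_edge : Finite Edge

attribute [instance] FiniteGraph.finite_vertex FiniteGraph.finite_edge

namespace FiniteGraph

/-- Every vertex is the final vertex of some edge. -/
def NoSources (E : FiniteGraph.{u}) : Prop := ∀ x : E.Vertex, ∃ e : E.Edge, E.r e = x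

/-- Every vertex is the initial vertex of some edge. -/
def NoSinks (E : FiniteGraph.{u}) : Prop := ∀ x : E.Vertex, ∃ e : E.Edge, E.s e = x

variable (E : FiniteGraph.{u})

/-- Final vertex of the walk `e₁ e₂ ⋯ e_m` starting at `x`, where `e_m` is walked first and
`e₁` is walked last; it is `x` for the empty walk. -/
def walkEnd (x : E.Vertex) : List E.Edge → E.Vertex
  | [] => x
  | e :: _ => E.r e

/-- The list `[e₁, e₂, …, e_m]` can be walked starting at `x` (`e_m` first, `e₁` last). -/
def IsWalk (x : E.Vertex) : List E.Edge → Prop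
  | [] => True
  | e :: l => E.s e = E.walkEnd x l ∧ IsWalk x l

/-- The set `E*` of finite paths `w = e₁ e₂ ⋯ e_m` of `E`, with `s(eᵢ) = r(eᵢ₊₁)`.
The trivial path at a vertex `x` has `start = x` and no edges; for a nonempty path, `start` is
forced to be `s(e_m)`. -/
@[ext]
structure Path where
  start : E.Vertex
  edges : List E.Edge
  isWalk : E.IsWalk start edges

variable {E}

theorem walkEnd_append (x : E.Vertex) (l l' : List E.Edge) :
    E.walkEnd x (l ++ l') = E.walkEnd (E.walkEnd x l') l := by
  cases l <;> rfl

theorem isWalk_append (x : E.Vertex) (l l' : List E.Edge) :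
    E.IsWalk x (l ++ l') ↔ E.IsWalk (E.walkEnd x l') l ∧ E.IsWalk x l' := by
  induction l with
  | nil => simp [IsWalk]
  | cons e l ih => simp [IsWalk, ih, walkEnd_append, and_assoc]

namespace Path

/-- The length `|w|`. -/
def length (w : E.Path) : ℕ := w.edges.length

/-- The final vertex `r(w)`; the initial vertex `s(w)` is `w.start`. -/
def range (w : E.Path) : E.Vertex := E.walkEnd w.start w.edges

/-- The trivial path at `x`. -/
def vertex (x : E.Vertex) : E.Path := ⟨x, [], trivial⟩

/-- The path `e w`, defined when `s(e) = r(w)`. -/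
def cons (e : E.Edge) (w : E.Path) (h : E.s e = w.range) : E.Path :=
  ⟨w.start, e :: w.edges, h, w.isWalk⟩

/-- The path `w v`, defined when `s(w) = r(v)`. -/
def append (w v : E.Path) (h : w.start = v.range) : E.Path :=
  ⟨v.start, w.edges ++ v.edges,
    (isWalk_append _ _ _).2 ⟨by have := w.isWalk; rwa [h] at this, v.isWalk⟩⟩

/-- The path `w(n)`: writing `w = w(n) v` with `|w(n)| < n` and `|v|` a multiple of `n`, it is
made of the `|w| mod n` edges of `w` that are walked last. See `length_rem_lt` and
`exists_rem_append` for this factorization. -/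
def rem (n : ℕ) (w : E.Path) : E.Path where
  start := E.walkEnd w.start (w.edges.drop (w.length % n))
  edges := w.edges.take (w.length % n)
  isWalk := by
    have h := w.isWalk
    rw [← List.take_append_drop (w.length % n) w.edges, isWalk_append] at h
    exact h.1

@[simp] theorem length_rem (n : ℕ) (w : E.Path) : (w.rem n).length = w.length % n := by
  simp only [rem, length, List.length_take]
  exact min_eq_left (Nat.mod_le _ _)

theorem length_rem_lt {n : ℕ} (hn : 0 < n) (w : E.Path) : (w.rem n).length < n := by
  rw [length_rem]; exact Nat.mod_lt _ hn

@[simp] theorem range_rem (n : ℕ) (w : E.Path) : (w.rem n).range = w.range := by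
  simp only [rem, range]
  rw [← walkEnd_append, List.take_append_drop]

theorem exists_rem_append (n : ℕ) (w : E.Path) :
    ∃ (v : E.Path) (h : (w.rem n).start = v.range), n ∣ v.length ∧ w = (w.rem n).append v h := by
  have hw := w.isWalk
  rw [← List.take_append_drop (w.length % n) w.edges, isWalk_append] at hw
  refine ⟨⟨w.start, w.edges.drop (w.length % n), hw.2⟩, rfl, ?_, ?_⟩
  · simp only [length, List.length_drop]
    exact Nat.dvd_sub_mod _
  · ext1
    · rfl
    · simp [append, rem]

theorem rem_rem {n N : ℕ} (h : n ∣ N) (w : E.Path) : (w.rem N).rem n = w.rem n := by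
  have h1 : w.length % N % n = w.length % n := Nat.mod_mod_of_dvd _ h
  have h2 : w.length % n ≤ w.length % N := h1 ▸ Nat.mod_le _ _
  ext1
  · change E.walkEnd (E.walkEnd w.start (w.edges.drop (w.length % N)))
      ((w.edges.take (w.length % N)).drop ((w.rem N).length % n)) = _
    rw [length_rem, h1, ← walkEnd_append]
    change _ = E.walkEnd w.start (w.edges.drop (w.length % n))
    congr 1
    conv_rhs => rw [← List.take_append_drop (w.length % N) w.edges]
    rw [List.drop_append_of_le_length]
    have h3 := length_rem N w
    change (w.edges.take (w.length % N)).length = w.length % N at h3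
    omega
  · change (w.edges.take (w.length % N)).take ((w.rem N).length % n) =
      w.edges.take (w.length % n)
    rw [length_rem, h1, List.take_take, min_eq_left h2]

instance finite_length_lt (n : ℕ) : Finite {w : E.Path // w.length < n} := by
  have : Finite {l : List E.Edge // l.length < n} := List.finite_length_lt E.Edge n
  refine Finite.of_injective
    (β := E.Vertex × {l : List E.Edge // l.length < n}) (fun w => ⟨w.1.start, w.1.edges, w.2⟩) ?_
  rintro ⟨w, hw⟩ ⟨w', hw'⟩ h
  simp only [Prod.mk.injEq] at h
  exact Subtype.ext (Path.ext h.1 (congrArg Subtype.val h.2))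

end Path

variable (E) in
/-- The graph `E(n)`. Its vertices are the paths of `E` of length `< n`, its edges the pairs
`(e, w)` with `s(e) = r(w)`; the source of `(e, w)` is `w` and its range is `e w` if
`|w| < n - 1` and the vertex `r(e)` if `|w| = n - 1`. -/
def power (n : ℕ) : FiniteGraph.{u} where
  Vertex := {w : E.Path // w.length < n}
  Edge := {p : E.Edge × {w : E.Path // w.length < n} // E.s p.1 = p.2.1.range}
  s p := p.1.2
  r p :=
    if h : p.1.2.1.length + 1 < n then ⟨Path.cons p.1.1 p.1.2.1 p.2, h⟩
    else ⟨Path.vertex (E.r p.1.1), Nat.lt_of_le_of_lt (Nat.zero_le _) p.1.2.2⟩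
  finite_vertex := inferInstance
  finite_edge := inferInstance

end FiniteGraph

open FiniteGraph

/-! ## Factor maps -/

/-- A factor map `(m⁰, m¹)` from `F` to `E`. -/
structure IsFactorMap (F E : FiniteGraph.{u}) (m0 : F.Vertex → E.Vertex)
    (m1 : F.Edge → E.Edge) : Prop where
  range_comp : ∀ e, E.r (m1 e) = m0 (F.r e)
  source_comp : ∀ e, E.s (m1 e) = m0 (F.s e)
  unique_lift : ∀ (e' : E.Edge) (v : F.Vertex), E.s e' = m0 v →
    ∃! e : F.Edge, m1 e = e' ∧ F.s e = v

/-- A regular factor map from `F` to `E`. -/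
structure IsRegularFactorMap (F E : FiniteGraph.{u}) (m0 : F.Vertex → E.Vertex)
    (m1 : F.Edge → E.Edge) : Prop extends IsFactorMap F E m0 m1 where
  regular : ∀ v : F.Vertex, (∃ e', E.r e' = m0 v) → ∃ e, F.r e = v

/-- The map `E(N)⁰ → E(n)⁰`, `w ↦ w(n)`. -/
def remVertex (E : FiniteGraph.{u}) {n : ℕ} (hn : 0 < n) (N : ℕ) :
    (E.power N).Vertex → (E.power n).Vertex :=
  fun w => ⟨w.1.rem n, w.1.length_rem_lt hn⟩

/-- The map `E(N)¹ → E(n)¹`, `(e, w) ↦ (e, w(n))`. -/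
def remEdge (E : FiniteGraph.{u}) {n : ℕ} (hn : 0 < n) (N : ℕ) :
    (E.power N).Edge → (E.power n).Edge :=
  fun p => ⟨(p.1.1, remVertex E hn N p.1.2), p.2.trans (Path.range_rem n p.1.2.1).symm⟩

/-! ## The Cuntz-Krieger algebra of a finite graph -/

/-- `{P_x, S_e}` is a Cuntz-Krieger `E`-family. (At a vertex `x` with `r⁻¹(x)` empty the
relation `∑_{r(e) = x} S_e S_e* ≤ P_x` says `0 ≤ P_x`, and so holds for any projection.) -/
structure IsCKFamily (E : FiniteGraph.{u}) {A : Type*} [NonUnitalRing A] [StarRing A]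
    (P : E.Vertex → A) (S : E.Edge → A) : Prop where
  isStarProjection : ∀ x, IsStarProjection (P x)
  orthogonal : ∀ x y, x ≠ y → P x * P y = 0
  star_mul_of_ne : ∀ e f, e ≠ f → star (S e) * S f = 0
  star_mul_self : ∀ e, star (S e) * S e = P (E.s e)
  sum_mul_star : ∀ x, (∃ e, E.r e = x) →
    ∑ᶠ e : {e : E.Edge // E.r e = x}, S e * star (S e) = P x

/-- A Cuntz-Krieger `E`-family in some C*-algebra. -/
structure CKRep (E : FiniteGraph.{u}) : Type (u + 1) where
  A : Type u
  [cstar : NonUnitalCStarAlgebra A]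
  P : E.Vertex → A
  S : E.Edge → A
  isCKFamily : IsCKFamily E P S

attribute [instance] CKRep.cstar

theorem IsCKFamily.norm_P_le {E : FiniteGraph.{u}} {A : Type*} [NonUnitalCStarAlgebra A]
    {P : E.Vertex → A} {S : E.Edge → A} (h : IsCKFamily E P S) (x : E.Vertex) : ‖P x‖ ≤ 1 :=
  (h.isStarProjection x).norm_le

theorem IsCKFamily.norm_S_le {E : FiniteGraph.{u}} {A : Type*} [NonUnitalCStarAlgebra A]
    {P : E.Vertex → A} {S : E.Edge → A} (h : IsCKFamily E P S) (e : E.Edge) : ‖S e‖ ≤ 1 := by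
  have h1 : ‖S e‖ * ‖S e‖ ≤ 1 := by
    rw [← CStarRing.norm_star_mul_self, h.star_mul_self]
    exact h.norm_P_le _
  nlinarith [norm_nonneg (S e)]

/-- The C*-algebra of bounded families indexed by all Cuntz-Krieger `E`-families. -/
abbrev CKProduct (E : FiniteGraph.{u}) : Type (u + 1) := lp (fun i : CKRep E => i.A) ∞

/-- The projections of the universal Cuntz-Krieger `E`-family: all projections `P_x` at once. -/
def univP (E : FiniteGraph.{u}) (x : E.Vertex) : CKProduct E :=
  ⟨fun i => i.P x, memℓp_infty ⟨1, by
    rintro _ ⟨i, rfl⟩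
    exact i.isCKFamily.norm_P_le x⟩⟩

/-- The partial isometries of the universal Cuntz-Krieger `E`-family. -/
def univS (E : FiniteGraph.{u}) (e : E.Edge) : CKProduct E :=
  ⟨fun i => i.S e, memℓp_infty ⟨1, by
    rintro _ ⟨i, rfl⟩
    exact i.isCKFamily.norm_S_le e⟩⟩

/-- The universal C*-algebra `O(E)`: the C*-algebra generated by the universal Cuntz-Krieger
`E`-family. `CK.isCKFamily` and `CK.exists_lift` below are its defining properties. (A C*-algebra
generated by a finite family has at most the cardinality of the continuum, so that every universe
contains a copy of it.) -/
def CKSubalgebra (E : FiniteGraph.{u}) : NonUnitalStarSubalgebra ℂ (CKProduct E) :=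
  (NonUnitalStarAlgebra.adjoin ℂ
    (Set.range (univP E) ∪ Set.range (univS E))).topologicalClosure

/-- The underlying type of the C*-algebra `O(E)`. -/
def CK (E : FiniteGraph.{u}) : Type (u + 1) := CKSubalgebra E

instance (E : FiniteGraph.{u}) : NonUnitalCStarAlgebra (CK E) :=
  NonUnitalStarSubalgebra.nonUnitalCStarAlgebra (CKSubalgebra E)
    (h_closed := NonUnitalStarSubalgebra.isClosed_topologicalClosure _)

/-- The generating projections `P_x` of `O(E)`. -/
def CK.P (E : FiniteGraph.{u}) (x : E.Vertex) : CK E :=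
  ⟨univP E x, NonUnitalStarSubalgebra.le_topologicalClosure _
    (NonUnitalStarAlgebra.subset_adjoin ℂ _ (Or.inl ⟨x, rfl⟩))⟩

/-- The generating partial isometries `S_e` of `O(E)`. -/
def CK.S (E : FiniteGraph.{u}) (e : E.Edge) : CK E :=
  ⟨univS E e, NonUnitalStarSubalgebra.le_topologicalClosure _
    (NonUnitalStarAlgebra.subset_adjoin ℂ _ (Or.inr ⟨e, rfl⟩))⟩

/-- Evaluation of `O(E)` at a Cuntz-Krieger `E`-family. -/
def CK.lift {E : FiniteGraph.{u}} (i : CKRep E) : CK E →⋆ₙₐ[ℂ] i.A where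
  toFun a := a.1 i
  map_smul' _ _ := rfl
  map_zero' := rfl
  map_add' _ _ := rfl
  map_mul' _ _ := rfl
  map_star' _ := rfl

theorem CK.ext_eval {E : FiniteGraph.{u}} {a b : CK E} (h : ∀ i, CK.lift i a = CK.lift i b) :
    a = b :=
  Subtype.ext (lp.ext (funext h))

theorem CK.isCKFamily (E : FiniteGraph.{u}) : IsCKFamily E (CK.P E) (CK.S E) where
  isStarProjection x := by
    refine ⟨CK.ext_eval fun i => ?_, CK.ext_eval fun i => ?_⟩
    · exact (i.isCKFamily.isStarProjection x).isIdempotentElem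
    · exact (i.isCKFamily.isStarProjection x).isSelfAdjoint
  orthogonal x y h := CK.ext_eval fun i => i.isCKFamily.orthogonal x y h
  star_mul_of_ne e f h := CK.ext_eval fun i => i.isCKFamily.star_mul_of_ne e f h
  star_mul_self e := CK.ext_eval fun i => i.isCKFamily.star_mul_self e
  sum_mul_star x hx := CK.ext_eval fun i => by
    have := Fintype.ofFinite {e : E.Edge // E.r e = x}
    have h := i.isCKFamily.sum_mul_star x hx
    rw [finsum_eq_sum_of_fintype] at h ⊢
    rw [map_sum]
    exact h

/-- The universal property of `O(E)`. -/
theorem CK.exists_lift {E : FiniteGraph.{u}} {A : Type u} [NonUnitalCStarAlgebra A]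
    (P : E.Vertex → A) (S : E.Edge → A) (h : IsCKFamily E P S) :
    ∃ φ : CK E →⋆ₙₐ[ℂ] A, (∀ x, φ (CK.P E x) = P x) ∧ ∀ e, φ (CK.S E e) = S e :=
  ⟨CK.lift ⟨A, P, S, h⟩, fun _ => rfl, fun _ => rfl⟩

/-- The *-homomorphism `μ : O(E) → O(F)` is the one determined by the maps `m⁰ : F⁰ → E⁰` and
`m¹ : F¹ → E¹`. -/
def IsInducedHom {F E : FiniteGraph.{u}} (m0 : F.Vertex → E.Vertex) (m1 : F.Edge → E.Edge)
    (μ : CK E →⋆ₙₐ[ℂ] CK F) : Prop :=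
  (∀ v : E.Vertex, μ (CK.P E v) = ∑ᶠ u : {u : F.Vertex // m0 u = v}, CK.P F u) ∧
  ∀ e : E.Edge, μ (CK.S E e) = ∑ᶠ f : {f : F.Edge // m1 f = e}, CK.S F f

/-! ## Weighted shifts and the algebras `A(n)` and `B(n)` -/

/-- The Hilbert space `ℓ²(E*)`. -/
abbrev PathSpace (E : FiniteGraph.{u}) : Type u := lp (fun _ : E.Path => ℂ) 2

/-- Bounded operators on `ℓ²(E*)`. -/
abbrev PathOp (E : FiniteGraph.{u}) : Type u := PathSpace E →L[ℂ] PathSpace E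

open Classical in
/-- The basis vector `ξ_w`. -/
def ξ {E : FiniteGraph.{u}} (w : E.Path) : PathSpace E := lp.single 2 w 1

open Classical in
/-- The operators `T_e` form the weighted shift with weights `lam` on `ℓ²(E*)`: `T_e ξ_w` is
`lam(ew) ξ_{ew}` if `s(e) = r(w)`, and `0` otherwise. The values of `lam` at the trivial paths play
no role. -/
def IsWeightedShift (E : FiniteGraph.{u}) (lam : E.Path → ℂ) (T : E.Edge → PathOp E) : Prop :=
  ∀ (e : E.Edge) (w : E.Path),
    T e (ξ w) = if h : E.s e = w.range then lam (w.cons e h) • ξ (w.cons e h) else 0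

/-- The weights are periodic of period `n`: `lam(ew) = lam(e w(n))`, so that they are determined
by the weights of the paths of length `1, …, n`. -/
def IsPeriodicWeight (E : FiniteGraph.{u}) (n : ℕ) (lam : E.Path → ℂ) : Prop :=
  ∀ (e : E.Edge) (w : E.Path) (h : E.s e = w.range),
    lam (w.cons e h) = lam ((w.rem n).cons e (h.trans (w.range_rem n).symm))

/-- The set of all operators `T_e` from all `n`-periodic weighted shifts on `ℓ²(E*)`. -/
def periodicShiftOps (E : FiniteGraph.{u}) (n : ℕ) : Set (PathOp E) :=
  {X | ∃ (lam : E.Path → ℂ) (T : E.Edge → PathOp E) (e : E.Edge),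
    IsWeightedShift E lam T ∧ IsPeriodicWeight E n lam ∧ X = T e}

/-- The C*-algebra `A(n)` generated by all `n`-periodic weighted shifts. (For a graph without
sinks the identity is `∑_x L_e* L_e` for a choice of edges `e` with `s(e) = x`, and so adding it to
the generators changes nothing.) -/
def shiftAlg (E : FiniteGraph.{u}) (n : ℕ) : StarSubalgebra ℂ (PathOp E) :=
  (StarAlgebra.adjoin ℂ (periodicShiftOps E n)).topologicalClosure

/-- The projection `R_x` of `ℓ²(E*)` onto the closed span of the `ξ_w` with `s(w) = x`. -/
def startProj (E : FiniteGraph.{u}) (x : E.Vertex) : PathOp E :=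
  (Submodule.span ℂ {v | ∃ w : E.Path, w.start = x ∧ v = ξ w}).topologicalClosure.starProjection

/-- The algebra `𝔎_E = ⊕_x R_x 𝔎 R_x` of block-diagonal compact operators. -/
def blockCompacts (E : FiniteGraph.{u}) : Set (PathOp E) :=
  {K | IsCompactOperator K ∧ K = ∑ᶠ x : E.Vertex, startProj E x * K * startProj E x}

theorem inner_ξ_of_ne {E : FiniteGraph.{u}} {v w : E.Path} (h : v ≠ w) :
    inner ℂ (ξ v) (ξ w) = 0 := by
  classical
  unfold ξ
  rw [lp.inner_single_left]
  simp [lp.single_apply, h]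

theorem startProj_ξ_of_eq {E : FiniteGraph.{u}} {x : E.Vertex} {w : E.Path} (h : w.start = x) :
    startProj E x (ξ w) = ξ w :=
  Submodule.starProjection_eq_self_iff.2
    (Submodule.le_topologicalClosure _ (Submodule.subset_span ⟨w, h, rfl⟩))

theorem startProj_ξ_of_ne {E : FiniteGraph.{u}} {x : E.Vertex} {w : E.Path} (h : w.start ≠ x) :
    startProj E x (ξ w) = 0 := by
  refine (Submodule.starProjection_apply_eq_zero_iff _).2 ?_
  rw [Submodule.orthogonal_closure]
  refine (Submodule.mem_orthogonal _ _).2 fun v hv => ?_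
  induction hv using Submodule.span_induction with
  | mem v hv =>
    obtain ⟨w', hw', rfl⟩ := hv
    exact inner_ξ_of_ne (by rintro rfl; exact h hw')
  | zero => simp
  | add a b _ _ ha hb => rw [inner_add_left, ha, hb, add_zero]
  | smul c a _ ha => rw [inner_smul_left, ha, mul_zero]

theorem pathOp_ext {E : FiniteGraph.{u}} {S T : PathOp E} (h : ∀ w : E.Path, S (ξ w) = T (ξ w)) :
    S = T := by
  classical
  ext1 v
  have hv : HasSum (fun w => lp.single 2 w (v w)) v := lp.hasSum_single ENNReal.ofNat_ne_top v
  have hs : ∀ w, (lp.single 2 w (v w) : PathSpace E) = v w • ξ w := by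
    intro w
    unfold ξ
    rw [← lp.single_smul, smul_eq_mul, mul_one]
  simp_rw [hs] at hv
  have h1 := hv.mapL S
  have h2 := hv.mapL T
  simp_rw [map_smul, h] at h1
  simp_rw [map_smul] at h2
  exact h1.unique h2

theorem startProj_comm_shift {E : FiniteGraph.{u}} {lam : E.Path → ℂ} {T : E.Edge → PathOp E}
    (hT : IsWeightedShift E lam T) (x : E.Vertex) (e : E.Edge) :
    startProj E x * T e = T e * startProj E x := by
  refine pathOp_ext fun w => ?_
  change startProj E x (T e (ξ w)) = T e (startProj E x (ξ w))
  rw [hT e w]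
  by_cases hx : w.start = x
  · rw [startProj_ξ_of_eq hx, hT e w]
    split_ifs with h
    · rw [map_smul, startProj_ξ_of_eq (show (w.cons e h).start = x from hx)]
    · simp
  · rw [startProj_ξ_of_ne hx, map_zero]
    split_ifs with h
    · rw [map_smul, startProj_ξ_of_ne (show (w.cons e h).start ≠ x from hx), smul_zero]
    · simp

theorem star_startProj (E : FiniteGraph.{u}) (x : E.Vertex) :
    star (startProj E x) = startProj E x :=
  isSelfAdjoint_starProjection _

theorem startProj_comm {E : FiniteGraph.{u}} {n : ℕ} {a : PathOp E} (ha : a ∈ shiftAlg E n)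
    (x : E.Vertex) : startProj E x * a = a * startProj E x := by
  have h : shiftAlg E n ≤ StarSubalgebra.centralizer ℂ {startProj E x} := by
    refine StarSubalgebra.topologicalClosure_minimal (StarAlgebra.adjoin_le ?_) ?_
    · rintro _ ⟨lam, T, e, hT, -, rfl⟩
      simp only [SetLike.mem_coe, StarSubalgebra.mem_centralizer_iff, Set.mem_singleton_iff,
        forall_eq, star_startProj, and_self]
      exact startProj_comm_shift hT x e
    · rw [StarSubalgebra.coe_centralizer]
      exact Set.isClosed_centralizer _
  exact ((StarSubalgebra.mem_centralizer_iff ℂ).1 (h ha) _ rfl).1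

theorem isCompactOperator_star {H : Type*} [NormedAddCommGroup H] [InnerProductSpace ℂ H]
    [CompleteSpace H] {K : H →L[ℂ] H} (hK : IsCompactOperator K) :
    IsCompactOperator (star K : H →L[ℂ] H) := by
  refine (isCompactOperator_iff_isCompact_closure_image_closedBall
    ((star K : H →L[ℂ] H) : H →ₗ[ℂ] H) one_pos).2 ?_
  have hKK : IsCompactOperator (K ∘ (star K : H →L[ℂ] H)) := hK.comp_clm _
  have htb : TotallyBounded ((K ∘ (star K : H →L[ℂ] H)) '' Metric.closedBall 0 1) :=
    ((isCompactOperator_iff_isCompact_closure_image_closedBall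
      ((K * star K : H →L[ℂ] H) : H →ₗ[ℂ] H) one_pos).1 hKK).totallyBounded.subset subset_closure
  refine TotallyBounded.isCompact_of_isClosed (TotallyBounded.closure ?_) isClosed_closure
  rw [Metric.totallyBounded_iff]
  intro ε hε
  obtain ⟨t, htsub, htfin, htcov⟩ :=
    Metric.finite_approx_of_totallyBounded htb (ε ^ 2 / 4) (by positivity)
  have hsub : ∀ y ∈ t, ∃ x, x ∈ Metric.closedBall (0 : H) 1 ∧
      (K ∘ (star K : H →L[ℂ] H)) x = y := fun y hy => htsub hy
  choose! g hg hgt using hsub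
  refine ⟨(fun y => (star K : H →L[ℂ] H) (g y)) '' t, htfin.image _, ?_⟩
  rintro _ ⟨x, hx, rfl⟩
  obtain ⟨y, hy, hxy⟩ := Set.mem_iUnion₂.1 (htcov ⟨x, hx, rfl⟩)
  refine Set.mem_iUnion₂.2 ⟨_, ⟨y, hy, rfl⟩, ?_⟩
  rw [← hgt y hy, mem_ball_iff_norm] at hxy
  rw [mem_ball_iff_norm]
  change ‖(star K : H →L[ℂ] H) x - (star K : H →L[ℂ] H) (g y)‖ < ε
  change ‖K ((star K : H →L[ℂ] H) x) - K ((star K : H →L[ℂ] H) (g y))‖ < _ at hxy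
  rw [← map_sub] at hxy ⊢
  rw [← map_sub] at hxy
  set z := x - g y with hz
  have hzn : ‖z‖ ≤ 2 := by
    have h1 : ‖x‖ ≤ 1 := by simpa using hx
    have h2 : ‖g y‖ ≤ 1 := by simpa using hg y hy
    linarith [norm_sub_le x (g y)]
  have h3 : ‖(star K : H →L[ℂ] H) z‖ ^ 2 ≤ ‖z‖ * ‖K ((star K : H →L[ℂ] H) z)‖ := by
    rw [← inner_self_eq_norm_sq (𝕜 := ℂ), ContinuousLinearMap.star_eq_adjoint,
      ContinuousLinearMap.adjoint_inner_left]
    exact (RCLike.re_le_norm _).trans (norm_inner_le_norm _ _)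
  have h4 : ‖z‖ * ‖K ((star K : H →L[ℂ] H) z)‖ ≤ 2 * (ε ^ 2 / 4) :=
    mul_le_mul hzn hxy.le (norm_nonneg _) zero_le_two
  refine lt_of_pow_lt_pow_left₀ 2 hε.le ?_
  nlinarith [pow_pos hε 2]

/-- The ideal `𝔎_E` of `A(n)`. -/
def compactIdeal (E : FiniteGraph.{u}) (n : ℕ) : Ideal (shiftAlg E n) where
  carrier := {a | (a : PathOp E) ∈ blockCompacts E}
  zero_mem' := ⟨isCompactOperator_zero, by simp⟩
  add_mem' := by
    have := Fintype.ofFinite E.Vertex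
    rintro a b ⟨ha, ha'⟩ ⟨hb, hb'⟩
    refine ⟨ha.add hb, ?_⟩
    rw [finsum_eq_sum_of_fintype] at ha' hb' ⊢
    simp only [AddMemClass.coe_add, mul_add, add_mul, Finset.sum_add_distrib]
    rw [← ha', ← hb']
  smul_mem' := by
    have := Fintype.ofFinite E.Vertex
    rintro c a ⟨ha, ha'⟩
    refine ⟨ha.clm_comp (c : PathOp E), ?_⟩
    rw [finsum_eq_sum_of_fintype] at ha' ⊢
    simp only [smul_eq_mul, MulMemClass.coe_mul]
    conv_lhs => rw [ha', Finset.mul_sum]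
    refine Finset.sum_congr rfl fun x _ => ?_
    simp only [← mul_assoc]
    rw [startProj_comm c.2]

instance (E : FiniteGraph.{u}) (n : ℕ) : (compactIdeal E n).IsTwoSided where
  mul_mem_of_left := by
    have := Fintype.ofFinite E.Vertex
    rintro a c ⟨ha, ha'⟩
    refine ⟨ha.comp_clm (c : PathOp E), ?_⟩
    rw [finsum_eq_sum_of_fintype] at ha' ⊢
    simp only [MulMemClass.coe_mul]
    conv_lhs => rw [ha', Finset.sum_mul]
    refine Finset.sum_congr rfl fun x _ => ?_
    simp only [mul_assoc]
    rw [startProj_comm c.2]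

theorem star_mem_compactIdeal {E : FiniteGraph.{u}} {n : ℕ} {a : shiftAlg E n}
    (h : a ∈ compactIdeal E n) : star a ∈ compactIdeal E n := by
  have := Fintype.ofFinite E.Vertex
  obtain ⟨ha, ha'⟩ := h
  refine ⟨isCompactOperator_star ha, ?_⟩
  rw [finsum_eq_sum_of_fintype] at ha' ⊢
  simp only [StarMemClass.coe_star]
  conv_lhs => rw [ha', star_sum]
  simp [star_startProj, mul_assoc]

/-- The quotient `B(n) = A(n) / 𝔎_E`, as a *-algebra. -/
def quotAlg (E : FiniteGraph.{u}) (n : ℕ) : Type u := shiftAlg E n ⧸ compactIdeal E n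

instance (E : FiniteGraph.{u}) (n : ℕ) : Ring (quotAlg E n) :=
  inferInstanceAs (Ring (shiftAlg E n ⧸ compactIdeal E n))

instance (E : FiniteGraph.{u}) (n : ℕ) : Algebra ℂ (quotAlg E n) :=
  inferInstanceAs (Algebra ℂ (shiftAlg E n ⧸ compactIdeal E n))

/-- The quotient map `A(n) → B(n)`, as a homomorphism of algebras. -/
def toQuotAux (E : FiniteGraph.{u}) (n : ℕ) : shiftAlg E n →ₐ[ℂ] quotAlg E n :=
  Ideal.Quotient.mkₐ ℂ (compactIdeal E n)

theorem toQuotAux_surjective (E : FiniteGraph.{u}) (n : ℕ) :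
    Function.Surjective (toQuotAux E n) := Ideal.Quotient.mk_surjective

theorem toQuotAux_eq_zero {E : FiniteGraph.{u}} {n : ℕ} {a : shiftAlg E n} :
    toQuotAux E n a = 0 ↔ (a : PathOp E) ∈ blockCompacts E :=
  Ideal.Quotient.eq_zero_iff_mem

instance (E : FiniteGraph.{u}) (n : ℕ) : Star (quotAlg E n) where
  star := Quotient.map' star (by
    intro a b h
    rw [Submodule.quotientRel_def] at h ⊢
    rw [← star_sub]
    exact star_mem_compactIdeal h)

theorem star_toQuotAux {E : FiniteGraph.{u}} {n : ℕ} (a : shiftAlg E n) :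
    star (toQuotAux E n a) = toQuotAux E n (star a) := rfl

instance (E : FiniteGraph.{u}) (n : ℕ) : StarRing (quotAlg E n) where
  star_involutive x := by
    obtain ⟨a, rfl⟩ := toQuotAux_surjective E n x
    rw [star_toQuotAux, star_toQuotAux, star_star]
  star_mul x y := by
    obtain ⟨a, rfl⟩ := toQuotAux_surjective E n x
    obtain ⟨b, rfl⟩ := toQuotAux_surjective E n y
    rw [← map_mul, star_toQuotAux, star_mul, map_mul, star_toQuotAux, star_toQuotAux]
  star_add x y := by
    obtain ⟨a, rfl⟩ := toQuotAux_surjective E n x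
    obtain ⟨b, rfl⟩ := toQuotAux_surjective E n y
    rw [← map_add, star_toQuotAux, star_add, map_add, star_toQuotAux, star_toQuotAux]

/-- The quotient map `A(n) → B(n)`. -/
def toQuot (E : FiniteGraph.{u}) (n : ℕ) : shiftAlg E n →⋆ₐ[ℂ] quotAlg E n where
  __ := toQuotAux E n
  map_star' _ := rfl

theorem toQuot_surjective (E : FiniteGraph.{u}) (n : ℕ) :
    Function.Surjective (toQuot E n) := toQuotAux_surjective E n

theorem toQuot_eq_zero {E : FiniteGraph.{u}} {n : ℕ} {a : shiftAlg E n} :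
    toQuot E n a = 0 ↔ (a : PathOp E) ∈ blockCompacts E := toQuotAux_eq_zero

theorem shiftAlg_mono (E : FiniteGraph.{u}) {n N : ℕ} (h : n ∣ N) :
    shiftAlg E n ≤ shiftAlg E N := by
  refine StarSubalgebra.topologicalClosure_mono (StarAlgebra.adjoin_mono ?_)
  rintro _ ⟨lam, T, e, hT, hlam, rfl⟩
  refine ⟨lam, T, e, hT, fun f w hf => ?_, rfl⟩
  rw [hlam f w, hlam f (w.rem N)]
  simp only [Path.rem_rem h]

/-- The inclusion `A(n) ⊆ A(N)` for `n ∣ N`. -/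
def shiftIncl (E : FiniteGraph.{u}) {n N : ℕ} (h : n ∣ N) : shiftAlg E n →⋆ₐ[ℂ] shiftAlg E N :=
  StarSubalgebra.inclusion (shiftAlg_mono E h)

/-- The homomorphism `B(n) → B(N)` induced by the inclusion `A(n) ⊆ A(N)`. -/
def quotInclAux (E : FiniteGraph.{u}) {n N : ℕ} (h : n ∣ N) : quotAlg E n →ₐ[ℂ] quotAlg E N :=
  Ideal.Quotient.liftₐ (compactIdeal E n)
    ((toQuotAux E N).comp (shiftIncl E h : shiftAlg E n →ₐ[ℂ] shiftAlg E N))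
    (fun _ ha => toQuotAux_eq_zero.2 ha)

theorem quotInclAux_toQuot (E : FiniteGraph.{u}) {n N : ℕ} (h : n ∣ N) (a : shiftAlg E n) :
    quotInclAux E h (toQuot E n a) = toQuot E N (shiftIncl E h a) := rfl

/-- The *-homomorphism `ī : B(n) → B(N)` induced by the inclusion `A(n) ⊆ A(N)`, for `n ∣ N`. -/
def quotIncl (E : FiniteGraph.{u}) {n N : ℕ} (h : n ∣ N) : quotAlg E n →⋆ₐ[ℂ] quotAlg E N where
  __ := quotInclAux E h
  map_star' x := by
    obtain ⟨a, rfl⟩ := toQuot_surjective E n x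
    change quotInclAux E h (star (toQuot E n a)) = star (quotInclAux E h (toQuot E n a))
    rw [← map_star, quotInclAux_toQuot, quotInclAux_toQuot, map_star, map_star]

theorem quotIncl_toQuot (E : FiniteGraph.{u}) {n N : ℕ} (h : n ∣ N) (a : shiftAlg E n) :
    quotIncl E h (toQuot E n a) = toQuot E N (shiftIncl E h a) := quotInclAux_toQuot E h a

open Classical in
/-- `X` is the operator `T_{(e,w)}`: it maps `ξ_{w'}` to `ξ_{ew'}` if `w'(n) = w` and to `0`
otherwise. -/
def IsShiftOp {E : FiniteGraph.{u}} {n : ℕ} (p : (E.power n).Edge) (X : PathOp E) : Prop :=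
  ∀ w' : E.Path, X (ξ w') =
    if h : w'.rem n = p.1.2.1 then
      ξ (w'.cons p.1.1 (by rw [p.2, ← h, Path.range_rem]))
    else 0

open Classical in
/-- `X` is the projection `Q_w` onto the closed span of the `ξ_{w'}` with `w'(n) = w`. -/
def IsRemProj {E : FiniteGraph.{u}} {n : ℕ} (w : (E.power n).Vertex) (X : PathOp E) : Prop :=
  ∀ w' : E.Path, X (ξ w') = if w'.rem n = w.1 then ξ w' else 0

/-- `π : O(E(n)) → B(n)` is the canonical *-isomorphism, which maps the generators `P_w` and
`S_{(e,w)}` to the classes of `Q_w` and `T_{(e,w)}`. -/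
def IsCanonicalIso (E : FiniteGraph.{u}) (n : ℕ) (π : CK (E.power n) ≃⋆ₐ[ℂ] quotAlg E n) : Prop :=
  (∀ w, ∃ Q : shiftAlg E n, IsRemProj w (Q : PathOp E) ∧
    π (CK.P (E.power n) w) = toQuot E n Q) ∧
  ∀ p, ∃ T : shiftAlg E n, IsShiftOp p (T : PathOp E) ∧
    π (CK.S (E.power n) p) = toQuot E n T

/-- The *-homomorphism `π_N⁻¹ ∘ ī ∘ π_n : O(E(n)) → O(E(N))`, where `ī : B(n) → B(N)` is induced by
the inclusion of `A(n)` in `A(N)`. -/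
def connecting (E : FiniteGraph.{u}) {n N : ℕ} (h : n ∣ N)
    (πn : CK (E.power n) ≃⋆ₐ[ℂ] quotAlg E n) (πN : CK (E.power N) ≃⋆ₐ[ℂ] quotAlg E N) :
    CK (E.power n) →⋆ₙₐ[ℂ] CK (E.power N) where
  toFun a := πN.symm (quotIncl E h (πn a))
  map_smul' c a := by rw [map_smul, map_smul, map_smul]; rfl
  map_zero' := by rw [map_zero, map_zero, map_zero]
  map_add' a b := by rw [map_add, map_add, map_add]
  map_mul' a b := by rw [map_mul, map_mul, map_mul]
  map_star' a := by rw [map_star, map_star, map_star]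

end GraphAlg

end

open GraphAlg

universe v

/-! ### Scalar matrices acting on columns over a C*-algebra -/

noncomputable section

/-! The operators `T_(e,w)` and `Q_w` satisfy the Cuntz–Krieger relations of `E(n)` up to compacts:
the summation relation fails only on trivial paths (`remProj_mul_tailProj_one`). Every periodic
shift is a combination of the `T_(e,w)`. The quotient norm is the limit of `‖a Q‖` over the
projections `Q` onto long paths (`tendsto_norm_mul_tailProj`), which makes `B(n)` a C*-algebra, and
universality gives `φ : O(E(n)) → B(n)`.

The main point is that `φ` is injective. Instead of a gauge-invariant uniqueness theorem, an
averaging argument recovers `b` from any operator representing `φ(b)`. Let `(P, S)` be a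
Cuntz–Krieger `E(n)`-family. A path `w` of `E` lifts to `E(n)`, starting at the trivial path at
`s(w)` and ending at `w(n)`; let `S_w` be the product of the generators along the lift. Put `Φ_M(x)
= M⁻¹ ∑ ⟨ξ_v, x ξ_w⟩ S_v S_w*`, where `v` and `w` have lengths in `[nM, 2nM)`. Since `E` has no
sources, each length `j` contributes to `∑ S_w S_w*` the sum of the `P_v` with `|v| = j mod n`, so
the whole window gives `M ∑ P_v` (`rangeSum_blocks`). A matrix form of Cauchy–Schwarz then yields
`‖Φ_M(x)‖ ≤ ‖x‖`, and `Φ_M(1) = ∑ P_v` for `M > 0`.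

As `T_p` shifts lengths by one, `Φ_M(T_p y)` and `S_p Φ_M(y)` differ by two boundary rows of the
window. These have size at most `√M ‖y‖` before division by `M`, so they vanish in the limit;
likewise for `T_p*`. Compact operators are killed because the window moves to infinity. Products,
sums and norm limits preserve this relation (`AsympRel`), so every `b` is related to some `a` in the
class `φ(b)`. If `φ(b) = 0`, then `b ∑ P_v = 0` in every family, hence `b = 0`.

An injective homomorphism is isometric, so the range of `φ` is closed and contains the generators of
`B(n)`: `φ` is onto. Finally `w(n) = (w(nk))(n)` makes `Q_v` and `T_p` at level `n` the sums of
those at level `nk` over the fibres of `m`. This identifies the connecting map on generators and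
also proves that `μ_m` exists. Injectivity of the connecting map holds because both quotients use
the same condition of being block-diagonal and compact. -/

open scoped ComplexOrder MatrixOrder Matrix.Norms.L2Operator in
/-- A matrix `M` with `‖M‖ ≤ C` satisfies `C² - M*M = D*D` for some `D`. -/
theorem Matrix.exists_conjTranspose_mul_self_eq_of_bound {ι κ : Type v} [Fintype ι] [Fintype κ]
    [DecidableEq κ] (M : Matrix ι κ ℂ) (C : ℝ)
    (hM : ∀ v : κ → ℂ, ∑ i, ‖∑ j, M i j * v j‖ ^ 2 ≤ C ^ 2 * ∑ j, ‖v j‖ ^ 2) :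
    ∃ D : Matrix κ κ ℂ,
      ((C ^ 2 : ℝ) : ℂ) • (1 : Matrix κ κ ℂ) - M.conjTranspose * M = D.conjTranspose * D := by
  have hdot {m : Type v} [Fintype m] (v : m → ℂ) :
      star v ⬝ᵥ v = ((∑ i, ‖v i‖ ^ 2 : ℝ) : ℂ) := by
    simp [dotProduct, Complex.conj_mul']
  -- The quadratic form at `v` is `C²‖v‖² - ‖Mv‖²`; a positive element of the C*-algebra of matrices
  -- then factors as `D*D`.
  have hpsd : (((C ^ 2 : ℝ) : ℂ) • (1 : Matrix κ κ ℂ) - M.conjTranspose * M).PosSemidef := by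
    refine Matrix.PosSemidef.of_dotProduct_mulVec_nonneg ?_ fun v => ?_
    · refine Matrix.IsHermitian.sub ?_ (Matrix.isHermitian_conjTranspose_mul_self M)
      rw [Matrix.IsHermitian, Matrix.conjTranspose_smul, Matrix.conjTranspose_one]
      simp
    · rw [Matrix.sub_mulVec, dotProduct_sub, Matrix.smul_mulVec, Matrix.one_mulVec,
        dotProduct_smul, ← Matrix.mulVec_mulVec, Matrix.dotProduct_mulVec,
        ← Matrix.star_mulVec, hdot, hdot, smul_eq_mul, ← Complex.ofReal_mul,
        ← Complex.ofReal_sub]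
      exact Complex.zero_le_real.2 (sub_nonneg.2 (hM v))
  exact CStarAlgebra.nonneg_iff_eq_star_mul_self.1 hpsd.nonneg

open CStarAlgebra in
/-- Applying a scalar matrix of norm at most `C` to a column with entries in a C*-algebra. -/
theorem CStarAlgebra.norm_sum_smul_mul_star_le {A : Type*} [NonUnitalCStarAlgebra A]
    {ι κ : Type v} [Fintype ι] [Fintype κ] (M : Matrix ι κ ℂ) (C : ℝ)
    (hM : ∀ v : κ → ℂ, ∑ i, ‖∑ j, M i j * v j‖ ^ 2 ≤ C ^ 2 * ∑ j, ‖v j‖ ^ 2) (t : κ → A) :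
    ‖∑ i, (∑ j, star (M i j) • t j) * star (∑ j, star (M i j) • t j)‖ ≤
      C ^ 2 * ‖∑ j, t j * star (t j)‖ := by
  classical
  let : PartialOrder A := CStarAlgebra.spectralOrder A
  have : StarOrderedRing A := CStarAlgebra.spectralOrderedRing A
  obtain ⟨D, hD⟩ := Matrix.exists_conjTranspose_mul_self_eq_of_bound M C hM
  -- Such a sum depends on `N` only through `N*N`, so the relation between `M` and `D` carries over
  -- to `A`.
  have hexp {m : Type v} [Fintype m] (N : Matrix m κ ℂ) :
      ∑ i, (∑ j, star (N i j) • t j) * star (∑ j, star (N i j) • t j) =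
        ∑ j, ∑ k, (N.conjTranspose * N) j k • (t j * star (t k)) := by
    simp only [star_sum, star_smul, star_star, Finset.sum_mul_sum, smul_mul_smul_comm,
      Matrix.mul_apply, Matrix.conjTranspose_apply, Finset.sum_smul]
    rw [Finset.sum_comm]
    exact Finset.sum_congr rfl fun j _ => Finset.sum_comm
  have hdiff : (C ^ 2) • ∑ j, t j * star (t j) -
      ∑ i, (∑ j, star (M i j) • t j) * star (∑ j, star (M i j) • t j) =
      ∑ i, (∑ j, star (D i j) • t j) * star (∑ j, star (D i j) • t j) := by
    rw [hexp, hexp, ← hD]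
    simp only [Matrix.sub_apply, Matrix.smul_apply, Matrix.one_apply, sub_smul,
      Finset.sum_sub_distrib, Complex.coe_smul, smul_assoc, ite_smul, one_smul, zero_smul,
      smul_ite, smul_zero, Finset.sum_ite_eq, Finset.mem_univ, if_true, Finset.smul_sum]
  have hnn {m : Type v} [Fintype m] (f : m → A) : 0 ≤ ∑ i, f i * star (f i) :=
    Finset.sum_nonneg fun i _ => mul_star_self_nonneg _
  have hle := sub_nonneg.1 (hdiff ▸ hnn fun i => ∑ j, star (D i j) • t j)
  refine (CStarAlgebra.norm_le_norm_of_nonneg_of_le (hnn _) hle).trans ?_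
  rw [norm_smul, Real.norm_of_nonneg (sq_nonneg C)]

/-- The Cauchy-Schwarz inequality for finite families in a C*-algebra. -/
theorem CStarAlgebra.norm_sum_mul_star_sq_le {A : Type*} [NonUnitalCStarAlgebra A]
    {ι : Type*} [Fintype ι] (s t : ι → A) :
    ‖∑ i, s i * star (t i)‖ ^ 2 ≤ ‖∑ i, s i * star (s i)‖ * ‖∑ i, t i * star (t i)‖ := by
  let : PartialOrder A := CStarAlgebra.spectralOrder A
  have : StarOrderedRing A := CStarAlgebra.spectralOrderedRing A
  -- This is Cauchy–Schwarz in the Hilbert module `A^ι`, whose inner product of `x` and `y` is `∑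
  -- y_i x_i*`; hence `t` comes first.
  have h := CStarModule.norm_inner_le (A := A) (E := WithCStarModule A (ι → A))
    (x := (WithCStarModule.equiv A _).symm t) (y := (WithCStarModule.equiv A _).symm s)
  have h2 := pow_le_pow_left₀ (norm_nonneg _) h 2
  rw [mul_pow, WithCStarModule.pi_norm_sq, WithCStarModule.pi_norm_sq, mul_comm] at h2
  exact h2

/-- The norm of `∑ M_ij s_i t_j*` for a scalar matrix `M` of norm at most `C`. -/
theorem CStarAlgebra.norm_sum_sum_smul_mul_star_sq_le {A : Type*} [NonUnitalCStarAlgebra A]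
    {ι κ : Type v} [Fintype ι] [Fintype κ] (M : Matrix ι κ ℂ) (C : ℝ)
    (hM : ∀ v : κ → ℂ, ∑ i, ‖∑ j, M i j * v j‖ ^ 2 ≤ C ^ 2 * ∑ j, ‖v j‖ ^ 2)
    (s : ι → A) (t : κ → A) :
    ‖∑ i, ∑ j, M i j • (s i * star (t j))‖ ^ 2 ≤
      C ^ 2 * (‖∑ i, s i * star (s i)‖ * ‖∑ j, t j * star (t j)‖) := by
  -- The matrix is absorbed into the column `t`; the conjugates undo the star.
  have h := norm_sum_mul_star_sq_le s (fun i => ∑ j, star (M i j) • t j)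
  simp only [star_sum, star_smul, star_star, Finset.mul_sum, mul_smul_comm] at h
  refine h.trans ?_
  have h2 := norm_sum_smul_mul_star_le M C hM t
  simp only [star_sum, star_smul, star_star, Finset.mul_sum, mul_smul_comm] at h2
  calc _ ≤ ‖∑ i, s i * star (s i)‖ * (C ^ 2 * ‖∑ j, t j * star (t j)‖) := by gcongr
    _ = _ := by ring

end

noncomputable section

namespace GraphAlg

open FiniteGraph

variable {E : FiniteGraph.{u}}

/-! ### Remainders of paths under prepending an edge -/

namespace FiniteGraph.Path

theorem cons_inj {e e' : E.Edge} {w w' : E.Path} {h : E.s e = w.range} {h' : E.s e' = w'.range} :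
    w.cons e h = w'.cons e' h' ↔ e = e' ∧ w = w' := by
  constructor
  · intro H
    have h1 := congrArg Path.start H
    have h2 := congrArg Path.edges H
    simp only [cons, List.cons.injEq] at h1 h2
    exact ⟨h2.1, Path.ext h1 h2.2⟩
  · rintro ⟨rfl, rfl⟩; rfl

theorem cons_ne_vertex {e : E.Edge} {w : E.Path} {h : E.s e = w.range} {x : E.Vertex} :
    w.cons e h ≠ vertex x := by
  intro H
  simpa [cons, vertex] using congrArg Path.edges H

@[simp] theorem length_cons (e : E.Edge) (w : E.Path) (h : E.s e = w.range) :
    (w.cons e h).length = w.length + 1 := rfl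

@[simp] theorem length_vertex (x : E.Vertex) : (vertex x).length = 0 := rfl

theorem eq_vertex_or_cons (w : E.Path) :
    (∃ x, w = vertex x) ∨ ∃ e w' h, w = cons e w' h := by
  obtain ⟨x, l, hl⟩ := w
  cases l with
  | nil => exact Or.inl ⟨x, rfl⟩
  | cons e l => exact Or.inr ⟨e, ⟨x, l, hl.2⟩, hl.1, rfl⟩

theorem rem_of_length_lt {n : ℕ} {w : E.Path} (h : w.length < n) : w.rem n = w := by
  ext1
  · simp only [rem, Nat.mod_eq_of_lt h]
    simp [length, walkEnd]
  · simp only [rem, Nat.mod_eq_of_lt h]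
    simp [length]

/-- Prepending an edge raises `|w| mod n` by one, or resets it to `0` when it was `n - 1`. This
lemma and the next are the two branches of the range map of `E(n)`. -/
theorem rem_cons_of_lt {n : ℕ} {e : E.Edge} {w : E.Path} (h : E.s e = w.range)
    (hw : w.length % n + 1 < n) :
    (w.cons e h).rem n = (w.rem n).cons e (h.trans (w.range_rem n).symm) := by
  have h1 : (w.length + 1) % n = w.length % n + 1 := by
    rw [Nat.add_mod, Nat.mod_eq_of_lt (a := 1) (by omega), Nat.mod_eq_of_lt hw]
  ext1 <;> simp only [rem, length_cons, h1] <;> simp [cons]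

theorem rem_cons_of_eq {n : ℕ} {e : E.Edge} {w : E.Path} (h : E.s e = w.range)
    (hw : w.length % n + 1 = n) : (w.cons e h).rem n = vertex (E.r e) := by
  have h1 : (w.length + 1) % n = 0 := by
    rw [← Nat.mod_add_mod, hw, Nat.mod_self]
  ext1 <;> simp only [rem, length_cons, h1] <;> simp [cons, vertex, walkEnd]

/-- A graph without sources has paths of any length with any given final vertex. -/
theorem exists_length_eq_range_eq (hE : E.NoSources) (m : ℕ) (x : E.Vertex) :
    ∃ w : E.Path, w.length = m ∧ w.range = x := by
  induction m generalizing x with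
  | zero => exact ⟨vertex x, rfl, rfl⟩
  | succ m ih =>
    obtain ⟨e, rfl⟩ := hE x
    obtain ⟨w, rfl, hw⟩ := ih (E.s e)
    exact ⟨w.cons e hw.symm, rfl, rfl⟩

end FiniteGraph.Path

/-! ## The graph `E(n)` -/

/-- The vertex `w(n)` of `E(n)`. -/
def remV {n : ℕ} (hn : 0 < n) (w : E.Path) : (E.power n).Vertex := ⟨w.rem n, w.length_rem_lt hn⟩

/-- The edge `(e, w(n))` of `E(n)`. -/
def remE {n : ℕ} (hn : 0 < n) (e : E.Edge) (w : E.Path) (h : E.s e = w.range) :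
    (E.power n).Edge := ⟨(e, remV hn w), h.trans (w.range_rem n).symm⟩

theorem power_ext {n : ℕ} {p q : (E.power n).Edge} (h1 : p.1.1 = q.1.1)
    (h2 : p.1.2.1 = q.1.2.1) : p = q :=
  Subtype.ext (Prod.ext h1 (Subtype.ext h2))

theorem power_s_remE {n : ℕ} (hn : 0 < n) (e : E.Edge) (w : E.Path) (h : E.s e = w.range) :
    (E.power n).s (remE hn e w h) = remV hn w := rfl

/-- Consecutive edges of a path of `E` become consecutive edges of `E(n)`, so paths of `E` lift to
`E(n)`, with the remainders as the vertices visited. -/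
theorem power_r_remE {n : ℕ} (hn : 0 < n) (e : E.Edge) (w : E.Path) (h : E.s e = w.range) :
    (E.power n).r (remE hn e w h) = remV hn (w.cons e h) := by
  have hlt := w.length_rem_lt hn
  refine Subtype.ext ?_
  change (dite _ _ _ : {w : E.Path // w.length < n}).1 = (w.cons e h).rem n
  change (if h : (w.rem n).length + 1 < n then _ else _ : {w : E.Path // w.length < n}).1 = _
  rw [Path.length_rem] at hlt
  split_ifs with h1
  · rw [Path.length_rem] at h1
    rw [Path.rem_cons_of_lt h h1]; rfl
  · rw [Path.length_rem] at h1
    rw [Path.rem_cons_of_eq h (by omega)]; rfl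

theorem remV_val {n : ℕ} (hn : 0 < n) (w : (E.power n).Vertex) : remV hn w.1 = w :=
  Subtype.ext (Path.rem_of_length_lt w.2)

theorem remE_val {n : ℕ} (hn : 0 < n) (p : (E.power n).Edge) : remE hn p.1.1 p.1.2.1 p.2 = p :=
  power_ext rfl (Path.rem_of_length_lt p.1.2.2)

/-- Length grades the vertices of `E(n)` by residues mod `n`, and every edge has degree one;
`rangeSum_succ` rests on this. -/
theorem length_power_r {n : ℕ} (p : (E.power n).Edge) :
    ((E.power n).r p).1.length = (p.1.2.1.length + 1) % n := by
  have hn : 0 < n := Nat.lt_of_le_of_lt (Nat.zero_le _) p.1.2.2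
  rw [← remE_val hn p, power_r_remE]
  simp [remV, remE, Path.rem_of_length_lt p.1.2.2]

theorem power_noSources {n : ℕ} (hn : 0 < n) (hE : E.NoSources) : (E.power n).NoSources := by
  intro v
  -- A trivial path is the range only of edges `(e, w)` with `|w| = n - 1`, so a path `ew` of length
  -- exactly `n` ending at `x` is needed.
  obtain ⟨x, hx⟩ | ⟨e, w, h, hw⟩ := v.1.eq_vertex_or_cons
  · obtain ⟨w, hl, hw⟩ := Path.exists_length_eq_range_eq hE n x
    obtain ⟨y, rfl⟩ | ⟨e, w, h, rfl⟩ := w.eq_vertex_or_cons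
    · simp at hl; omega
    · refine ⟨remE hn e w h, ?_⟩
      rw [power_r_remE]
      refine Subtype.ext ?_
      change Path.rem n _ = _
      simp only [Path.length_cons] at hl
      rw [Path.rem_cons_of_eq h (by rw [Nat.mod_eq_of_lt] <;> omega), hx]
      congr
  · refine ⟨remE hn e w h, ?_⟩
    rw [power_r_remE, ← hw, remV_val]

theorem power_noSinks {n : ℕ} (hE : E.NoSinks) : (E.power n).NoSinks := by
  intro v
  obtain ⟨e, he⟩ := hE v.1.range
  exact ⟨⟨(e, v), he⟩, rfl⟩

/-- Compatibility with ranges is `(w(N))(n) = w(n)` applied to `ew`. Lifts are unique because an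
edge of a power graph is determined by its underlying edge and its source. -/
theorem isRegularFactorMap_rem (hE : E.NoSources) {n N : ℕ} (hn : 0 < n) (h : n ∣ N)
    (hN : 0 < N) :
    IsRegularFactorMap (E.power N) (E.power n) (remVertex E hn N) (remEdge E hn N) where
  range_comp p := by
    obtain ⟨e, w, hw, rfl⟩ : ∃ e w h, p = remE hN e w h := ⟨_, _, _, (remE_val hN p).symm⟩
    have h1 : remEdge E hn N (remE hN e w hw) = remE hn e w hw :=
      power_ext rfl (Path.rem_rem h w)
    rw [h1, power_r_remE, power_r_remE]
    exact Subtype.ext (Path.rem_rem h _).symm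
  source_comp p := rfl
  unique_lift p v hv := by
    refine ⟨⟨(p.1.1, v), ?_⟩, ⟨power_ext rfl ?_, rfl⟩, ?_⟩
    · have := p.2
      change p.1.2 = _ at hv
      rw [hv] at this
      exact this.trans (Path.range_rem n v.1)
    · exact (congrArg Subtype.val hv).symm
    · rintro q ⟨rfl, rfl⟩
      rfl
  regular v _ := power_noSources hN hE v

end GraphAlg

end

/-! ### Partial isometries permuting basis vectors -/

noncomputable section

open Classical in
/-- A partial injection `f` with domain `D` of an index set induces a partial isometry. -/
theorem lp.exists_single_apply_of_injOn {ι : Type*} (D : Set ι) (f : ι → ι)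
    (hf : Set.InjOn f D) :
    ∃ T : lp (fun _ : ι => ℂ) 2 →L[ℂ] lp (fun _ : ι => ℂ) 2, ∀ i,
      T (lp.single 2 i 1) = if i ∈ D then lp.single 2 (f i) 1 else 0 := by
  have h2 : 0 < (2 : ℝ≥0∞).toReal := by norm_num
  -- `g` inverts `f` on `f '' D`; the default value is irrelevant, since `F` vanishes off `f '' D`.
  let g (i : ι) : ι := if h : ∃ j ∈ D, f j = i then h.choose else i
  have hg {i : ι} (h : i ∈ f '' D) : g i ∈ D ∧ f (g i) = i := by
    have h' : ∃ j ∈ D, f j = i := h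
    simp only [g, dif_pos h']
    exact h'.choose_spec
  have hgf {j : ι} (h : j ∈ D) : g (f j) = j :=
    hf (hg ⟨j, h, rfl⟩).1 h (hg ⟨j, h, rfl⟩).2
  let F (x : ι → ℂ) (i : ι) : ℂ := if i ∈ f '' D then x (g i) else 0
  -- As `g` is injective on `f '' D`, partial sums for `F x` are partial sums for `x`. This gives
  -- both membership in `ℓ²` and the norm bound.
  have hF (x : lp (fun _ : ι => ℂ) 2) (s : Finset ι) :
      ∑ i ∈ s, ‖F x i‖ ^ (2 : ℝ≥0∞).toReal ≤ ‖x‖ ^ (2 : ℝ≥0∞).toReal := by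
    calc ∑ i ∈ s, ‖F x i‖ ^ (2 : ℝ≥0∞).toReal
        = ∑ i ∈ s with i ∈ f '' D, ‖x (g i)‖ ^ (2 : ℝ≥0∞).toReal := by
          rw [Finset.sum_filter]
          refine Finset.sum_congr rfl fun i _ => ?_
          by_cases h : i ∈ f '' D
          · simp only [F, if_pos h]
          · simp only [F, if_neg h]; simp
      _ = ∑ j ∈ Finset.image g {i ∈ s | i ∈ f '' D}, ‖x j‖ ^ (2 : ℝ≥0∞).toReal := by
          rw [Finset.sum_image]
          intro i hi j hj hij
          have hi' := (hg (Finset.mem_filter.1 hi).2).2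
          have hj' := (hg (Finset.mem_filter.1 hj).2).2
          rw [← hi', ← hj', hij]
      _ ≤ _ := lp.sum_rpow_le_norm_rpow h2 x _
  let T : lp (fun _ : ι => ℂ) 2 →ₗ[ℂ] lp (fun _ : ι => ℂ) 2 :=
    { toFun x := ⟨F x, memℓp_gen' (hF x)⟩
      map_add' x y := by
        refine lp.ext (funext fun i => ?_)
        change F (x + y) i = F x i + F y i
        by_cases h : i ∈ f '' D
        · simp only [F, if_pos h]; rfl
        · simp only [F, if_neg h, add_zero]
      map_smul' c x := by
        refine lp.ext (funext fun i => ?_)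
        change F (c • x) i = c • F x i
        by_cases h : i ∈ f '' D
        · simp only [F, if_pos h]; rfl
        · simp only [F, if_neg h, smul_zero] }
  refine ⟨T.mkContinuous 1 fun x => ?_, fun i => ?_⟩
  · rw [one_mul]
    exact lp.norm_le_of_forall_sum_le h2 (norm_nonneg _) (hF x)
  · refine lp.ext (funext fun j => ?_)
    change F (lp.single 2 i 1 : lp (fun _ : ι => ℂ) 2) j = _
    simp only [F]
    by_cases hj : j ∈ f '' D
    · rw [if_pos hj]
      obtain ⟨k, hk, rfl⟩ := hj
      rw [hgf hk]
      by_cases hki : k = i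
      · subst hki
        simp [hk]
      · rw [lp.single_apply_ne _ _ _ hki]
        split_ifs with hi
        · rw [lp.single_apply_ne]
          exact fun h => hki (hf hk hi h)
        · rfl
    · rw [if_neg hj]
      split_ifs with hi
      · rw [lp.single_apply_ne]
        rintro rfl
        exact hj ⟨i, hi, rfl⟩
      · rfl

namespace GraphAlg

open FiniteGraph

variable {E : FiniteGraph.{u}}

/-! ## Operators on `ℓ²(E*)` -/

theorem inner_ξ_left (w : E.Path) (x : PathSpace E) : inner ℂ (ξ w) x = x w := by
  classical
  unfold ξ
  rw [lp.inner_single_left]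
  simp

theorem ξ_apply_self (w : E.Path) : (ξ w : PathSpace E) w = 1 := by
  classical
  simp [ξ]

theorem ξ_apply_of_ne {v w : E.Path} (h : w ≠ v) : (ξ v : PathSpace E) w = 0 := by
  classical
  exact lp.single_apply_ne _ _ _ h

theorem norm_ξ (w : E.Path) : ‖(ξ w : PathSpace E)‖ = 1 := by
  classical
  simp [ξ, lp.norm_single]

theorem orthonormal_ξ : Orthonormal ℂ (fun w : E.Path => (ξ w : PathSpace E)) :=
  ⟨norm_ξ, fun _ _ h => inner_ξ_of_ne h⟩

/-- Matrix coefficients of the adjoint. -/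
theorem star_apply_ξ (T : PathOp E) (v w : E.Path) :
    (star T : PathOp E) (ξ v) w = star (T (ξ w) v) := by
  rw [← inner_ξ_left, ContinuousLinearMap.star_eq_adjoint,
    ContinuousLinearMap.adjoint_inner_right, ← inner_conj_symm, inner_ξ_left]
  rfl

theorem pathSpace_ext {x y : PathSpace E} (h : ∀ w, x w = y w) : x = y := lp.ext (funext h)

open Classical in
theorem exists_isShiftOp {n : ℕ} (p : (E.power n).Edge) : ∃ X : PathOp E, IsShiftOp p X := by
  -- On this domain `s(e) = r(w)` is automatic, so the default branch of the map is never taken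
  -- there.
  obtain ⟨T, hT⟩ := lp.exists_single_apply_of_injOn {w : E.Path | w.rem n = p.1.2.1}
    (fun w => if h : E.s p.1.1 = w.range then w.cons p.1.1 h else w) (by
      intro w hw w' hw' h
      have h1 : E.s p.1.1 = w.range := by rw [p.2, ← hw.out, Path.range_rem]
      have h2 : E.s p.1.1 = w'.range := by rw [p.2, ← hw'.out, Path.range_rem]
      simp only [dif_pos h1, dif_pos h2] at h
      exact (Path.cons_inj.1 h).2)
  refine ⟨T, fun w => ?_⟩
  unfold ξ
  rw [hT]
  by_cases h : w.rem n = p.1.2.1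
  · have h1 : E.s p.1.1 = w.range := by rw [p.2, ← h, Path.range_rem]
    rw [if_pos (show w ∈ {w : E.Path | w.rem n = p.1.2.1} from h), dif_pos h, dif_pos h1]
  · rw [if_neg (show w ∉ {w : E.Path | w.rem n = p.1.2.1} from h), dif_neg h]

open Classical in
theorem exists_diagonal (D : Set E.Path) :
    ∃ X : PathOp E, ∀ w, X (ξ w) = if w ∈ D then ξ w else 0 :=
  lp.exists_single_apply_of_injOn D id (Set.injOn_id D)

/-- The operator `T_{(e,w)}`. -/
def shiftOp {n : ℕ} (p : (E.power n).Edge) : PathOp E := (exists_isShiftOp p).choose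

/-- The projection onto the closed span of the `ξ_w` with `w ∈ D`. -/
def diagProj (D : Set E.Path) : PathOp E := (exists_diagonal D).choose

theorem diagProj_ξ_of_mem {D : Set E.Path} {w : E.Path} (h : w ∈ D) :
    diagProj D (ξ w) = ξ w := by
  classical
  rw [diagProj, (exists_diagonal D).choose_spec, if_pos h]

theorem diagProj_ξ_of_notMem {D : Set E.Path} {w : E.Path} (h : w ∉ D) :
    diagProj D (ξ w) = 0 := by
  classical
  rw [diagProj, (exists_diagonal D).choose_spec, if_neg h]

theorem isShiftOp_shiftOp {n : ℕ} (p : (E.power n).Edge) : IsShiftOp p (shiftOp p) :=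
  (exists_isShiftOp p).choose_spec

theorem IsShiftOp.eq_shiftOp {n : ℕ} {p : (E.power n).Edge} {X : PathOp E} (h : IsShiftOp p X) :
    X = shiftOp p :=
  pathOp_ext fun w => by rw [h w, isShiftOp_shiftOp p w]

/-- The projection `Q_w`. -/
def remProj {n : ℕ} (v : (E.power n).Vertex) : PathOp E := diagProj {w | w.rem n = v.1}

theorem remProj_ξ_of_eq {n : ℕ} {v : (E.power n).Vertex} {w : E.Path} (h : w.rem n = v.1) :
    remProj v (ξ w) = ξ w :=
  diagProj_ξ_of_mem h

theorem remProj_ξ_of_ne {n : ℕ} {v : (E.power n).Vertex} {w : E.Path} (h : w.rem n ≠ v.1) :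
    remProj v (ξ w) = 0 :=
  diagProj_ξ_of_notMem h

theorem isRemProj_remProj {n : ℕ} (v : (E.power n).Vertex) : IsRemProj v (remProj v) := by
  intro w
  split_ifs with h
  · exact remProj_ξ_of_eq h
  · exact remProj_ξ_of_ne h

theorem IsRemProj.eq_remProj {n : ℕ} {v : (E.power n).Vertex} {X : PathOp E}
    (h : IsRemProj v X) : X = remProj v :=
  pathOp_ext fun w => by rw [h w, isRemProj_remProj v w]

theorem shiftOp_ξ_of_ne {n : ℕ} {p : (E.power n).Edge} {w : E.Path} (h : w.rem n ≠ p.1.2.1) :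
    shiftOp p (ξ w) = 0 := by
  rw [isShiftOp_shiftOp p w, dif_neg h]

theorem shiftOp_ξ_of_eq {n : ℕ} (hn : 0 < n) {p : (E.power n).Edge} {w : E.Path}
    {h : E.s p.1.1 = w.range} (hp : p = remE hn p.1.1 w h) :
    shiftOp p (ξ w) = ξ (w.cons p.1.1 h) := by
  rw [isShiftOp_shiftOp p w, dif_pos]
  exact (congrArg (fun q : (E.power n).Edge => q.1.2.1) hp).symm

theorem shiftOp_remE_ξ {n : ℕ} (hn : 0 < n) (e : E.Edge) (w : E.Path) (h : E.s e = w.range) :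
    shiftOp (remE hn e w h) (ξ w) = ξ (w.cons e h) :=
  shiftOp_ξ_of_eq hn rfl

open Classical in
/-- The coefficient of `ξ_v` in `T_p ξ_w`. -/
theorem shiftOp_ξ_apply {n : ℕ} (p : (E.power n).Edge) (w v : E.Path) :
    shiftOp p (ξ w) v =
      if ∃ h, v = w.cons p.1.1 h ∧ w.rem n = p.1.2.1 then 1 else 0 := by
  rw [isShiftOp_shiftOp p w]
  by_cases h : w.rem n = p.1.2.1
  · rw [dif_pos h]
    by_cases hv : ∃ h, v = w.cons p.1.1 h
    · obtain ⟨h', rfl⟩ := hv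
      rw [ξ_apply_self, if_pos ⟨h', rfl, h⟩]
    · rw [ξ_apply_of_ne (fun H => hv ⟨_, H⟩), if_neg]
      exact fun ⟨h', H⟩ => hv ⟨h', H.1⟩
  · rw [dif_neg h, if_neg]
    · rfl
    · exact fun ⟨h', H⟩ => h H.2

/-- No `T_p` reaches a trivial path. This is the only defect in the Cuntz–Krieger relations on
`ℓ²(E*)`. -/
theorem star_shiftOp_ξ_vertex {n : ℕ} (p : (E.power n).Edge) (x : E.Vertex) :
    (star (shiftOp p) : PathOp E) (ξ (Path.vertex x)) = 0 := by
  refine pathSpace_ext fun v => ?_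
  rw [star_apply_ξ, shiftOp_ξ_apply, if_neg]
  · simp
  · exact fun ⟨h', H⟩ => Path.cons_ne_vertex H.1.symm

theorem star_shiftOp_remE_ξ_cons {n : ℕ} (hn : 0 < n) (e : E.Edge) (w : E.Path)
    (h : E.s e = w.range) :
    (star (shiftOp (remE hn e w h)) : PathOp E) (ξ (w.cons e h)) = ξ w := by
  refine pathSpace_ext fun v => ?_
  rw [star_apply_ξ, shiftOp_ξ_apply]
  by_cases hv : v = w
  · subst hv
    rw [if_pos ⟨h, rfl, rfl⟩, ξ_apply_self, star_one]
  · rw [if_neg, ξ_apply_of_ne hv, star_zero]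
    rintro ⟨h', H, -⟩
    exact hv (Path.cons_inj.1 H).2.symm

theorem star_shiftOp_ξ_cons_of_ne {n : ℕ} (hn : 0 < n) {p : (E.power n).Edge} {e : E.Edge}
    {w : E.Path} {h : E.s e = w.range} (hp : p ≠ remE hn e w h) :
    (star (shiftOp p) : PathOp E) (ξ (w.cons e h)) = 0 := by
  refine pathSpace_ext fun v => ?_
  rw [star_apply_ξ, shiftOp_ξ_apply, if_neg]
  · simp
  · rintro ⟨h', H, hv⟩
    obtain ⟨rfl, rfl⟩ := Path.cons_inj.1 H
    exact hp (power_ext rfl hv.symm)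

theorem star_diagProj (D : Set E.Path) : star (diagProj D) = diagProj D := by
  refine pathOp_ext fun w => pathSpace_ext fun v => ?_
  rw [star_apply_ξ]
  by_cases h : v = w
  · subst h
    by_cases hv : v ∈ D
    · rw [diagProj_ξ_of_mem hv, ξ_apply_self, star_one]
    · rw [diagProj_ξ_of_notMem hv]; simp
  · by_cases hv : v ∈ D <;> by_cases hw : w ∈ D <;>
      simp [diagProj_ξ_of_mem, diagProj_ξ_of_notMem, hv, hw, ξ_apply_of_ne h,
        ξ_apply_of_ne (Ne.symm h)]

theorem diagProj_mul_self (D : Set E.Path) : diagProj D * diagProj D = diagProj D := by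
  refine pathOp_ext fun w => ?_
  change diagProj D (diagProj D (ξ w)) = _
  by_cases hw : w ∈ D <;> simp [diagProj_ξ_of_mem, diagProj_ξ_of_notMem, hw]

theorem isStarProjection_diagProj (D : Set E.Path) : IsStarProjection (diagProj D) :=
  ⟨diagProj_mul_self D, star_diagProj D⟩

theorem diagProj_mul_of_disjoint {D D' : Set E.Path} (h : Disjoint D D') :
    diagProj D * diagProj D' = 0 := by
  refine pathOp_ext fun w => ?_
  change diagProj D (diagProj D' (ξ w)) = _
  by_cases hw : w ∈ D'
  · rw [diagProj_ξ_of_mem hw, diagProj_ξ_of_notMem (Set.disjoint_right.1 h hw)]; rfl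
  · rw [diagProj_ξ_of_notMem hw, map_zero]; rfl

end GraphAlg

end

noncomputable section
namespace GraphAlg

open FiniteGraph

variable {E : FiniteGraph.{u}} {n : ℕ}

/-! ## Relations between the operators `T_(e,w)` and `Q_w` -/

/-- The basic case split: `T_p` either moves `ξ_w`, and then `p` is the lifted edge at `w`, or kills
it. -/
theorem eq_remE_or_rem_ne (hn : 0 < n) (p : (E.power n).Edge) (w : E.Path) :
    (∃ e h, p = remE hn e w h) ∨ w.rem n ≠ p.1.2.1 := by
  by_cases h : w.rem n = p.1.2.1
  · exact Or.inl ⟨p.1.1, by rw [p.2, ← h, Path.range_rem], power_ext rfl h.symm⟩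
  · exact Or.inr h

theorem star_shiftOp_mul_shiftOp_of_ne (hn : 0 < n) {p q : (E.power n).Edge} (h : p ≠ q) :
    star (shiftOp p) * shiftOp q = 0 := by
  refine pathOp_ext fun w => ?_
  change (star (shiftOp p) : PathOp E) (shiftOp q (ξ w)) = _
  obtain ⟨e, h', rfl⟩ | hq := eq_remE_or_rem_ne hn q w
  · rw [shiftOp_remE_ξ, star_shiftOp_ξ_cons_of_ne hn h]; rfl
  · rw [shiftOp_ξ_of_ne hq, map_zero]; rfl

theorem star_shiftOp_mul_self (hn : 0 < n) (p : (E.power n).Edge) :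
    star (shiftOp p) * shiftOp p = remProj ((E.power n).s p) := by
  refine pathOp_ext fun w => ?_
  change (star (shiftOp p) : PathOp E) (shiftOp p (ξ w)) = _
  obtain ⟨e, h', rfl⟩ | hq := eq_remE_or_rem_ne hn p w
  · rw [shiftOp_remE_ξ, star_shiftOp_remE_ξ_cons]
    exact (remProj_ξ_of_eq rfl).symm
  · rw [shiftOp_ξ_of_ne hq, map_zero]
    exact (remProj_ξ_of_ne hq).symm

/-- The projection onto the closed span of the `ξ_w` with `|w| ≥ N`. -/
def tailProj (E : FiniteGraph.{u}) (N : ℕ) : PathOp E := diagProj {w | N ≤ w.length}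

theorem tailProj_ξ_of_le {N : ℕ} {w : E.Path} (h : N ≤ w.length) : tailProj E N (ξ w) = ξ w :=
  diagProj_ξ_of_mem h

theorem tailProj_ξ_of_lt {N : ℕ} {w : E.Path} (h : w.length < N) : tailProj E N (ξ w) = 0 :=
  diagProj_ξ_of_notMem (not_le.2 h)

theorem tailProj_zero : tailProj E 0 = 1 :=
  pathOp_ext fun _ => tailProj_ξ_of_le (Nat.zero_le _)

open Classical in
/-- The action of `∑ T_p X T_p*`, over some of the edges `p` of `E(n)`, on `ξ_{ew}`. -/
theorem sum_shiftOp_mul_mul_star_ξ_cons (hn : 0 < n) [Fintype (E.power n).Edge]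
    (s : Finset (E.power n).Edge) (X : PathOp E) (e : E.Edge) (w : E.Path) (h : E.s e = w.range) :
    (∑ p ∈ s, shiftOp p * X * star (shiftOp p)) (ξ (w.cons e h)) =
      if remE hn e w h ∈ s then shiftOp (remE hn e w h) (X (ξ w)) else 0 := by
  rw [_root_.sum_apply]
  have (p : (E.power n).Edge) : (shiftOp p * X * star (shiftOp p)) (ξ (w.cons e h)) =
      if p = remE hn e w h then shiftOp (remE hn e w h) (X (ξ w)) else 0 := by
    change shiftOp p (X ((star (shiftOp p) : PathOp E) (ξ (w.cons e h)))) = _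
    split_ifs with hp
    · rw [hp, star_shiftOp_remE_ξ_cons]
    · rw [star_shiftOp_ξ_cons_of_ne hn hp, map_zero, map_zero]
  rw [Finset.sum_congr rfl fun p _ => this p]
  simp

theorem sum_shiftOp_mul_mul_star_ξ_vertex (s : Finset (E.power n).Edge) (X : PathOp E)
    (x : E.Vertex) :
    (∑ p ∈ s, shiftOp p * X * star (shiftOp p)) (ξ (Path.vertex x)) = 0 := by
  rw [_root_.sum_apply]
  refine Finset.sum_eq_zero fun p _ => ?_
  change shiftOp p (X ((star (shiftOp p) : PathOp E) (ξ (Path.vertex x)))) = _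
  rw [star_shiftOp_ξ_vertex, map_zero, map_zero]

/-- A path of positive length is `ew` in exactly one way, and `(e, w(n))` is the only `p` whose
adjoint does not kill `ξ_{ew}`. The recursion puts the tail projections into `A(n)`. -/
theorem tailProj_succ (hn : 0 < n) [Fintype (E.power n).Edge] (N : ℕ) :
    tailProj E (N + 1) = ∑ p : (E.power n).Edge, shiftOp p * tailProj E N * star (shiftOp p) := by
  classical
  refine pathOp_ext fun w => ?_
  obtain ⟨x, rfl⟩ | ⟨e, w, h, rfl⟩ := w.eq_vertex_or_cons
  · rw [sum_shiftOp_mul_mul_star_ξ_vertex, tailProj_ξ_of_lt (by simp)]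
  · rw [sum_shiftOp_mul_mul_star_ξ_cons hn, if_pos (Finset.mem_univ _)]
    by_cases hN : N ≤ w.length
    · rw [tailProj_ξ_of_le hN, tailProj_ξ_of_le (by simpa), shiftOp_remE_ξ]
    · rw [tailProj_ξ_of_lt (not_le.1 hN),
        tailProj_ξ_of_lt (by rw [Path.length_cons]; omega), map_zero]

/-- The Cuntz–Krieger relation at `v` is exact off the trivial paths. These are finite in number, so
it becomes exact modulo compacts. -/
theorem remProj_mul_tailProj_one (hn : 0 < n) [Fintype (E.power n).Edge]
    [DecidableEq (E.power n).Vertex] (v : (E.power n).Vertex) :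
    remProj v * tailProj E 1 =
      ∑ p : (E.power n).Edge with (E.power n).r p = v, shiftOp p * star (shiftOp p) := by
  classical
  refine pathOp_ext fun w => ?_
  change remProj v (tailProj E 1 (ξ w)) = _
  have h1 (p : (E.power n).Edge) :
      shiftOp p * star (shiftOp p) = shiftOp p * 1 * star (shiftOp p) := by rw [mul_one]
  rw [Finset.sum_congr rfl fun p _ => h1 p]
  obtain ⟨x, rfl⟩ | ⟨e, w, h, rfl⟩ := w.eq_vertex_or_cons
  · rw [sum_shiftOp_mul_mul_star_ξ_vertex, tailProj_ξ_of_lt (by simp), map_zero]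
  · rw [sum_shiftOp_mul_mul_star_ξ_cons hn, tailProj_ξ_of_le (by simp)]
    simp only [Finset.mem_filter, Finset.mem_univ, true_and, power_r_remE]
    change _ = if _ then shiftOp _ (ξ w) else 0
    rw [shiftOp_remE_ξ]
    split_ifs with hv
    · subst hv
      exact remProj_ξ_of_eq rfl
    · exact remProj_ξ_of_ne fun H => hv (Subtype.ext H)

theorem sum_remProj (hn : 0 < n) [Fintype (E.power n).Vertex] :
    ∑ v : (E.power n).Vertex, remProj v = 1 := by
  classical
  refine pathOp_ext fun w => ?_
  rw [_root_.sum_apply, Finset.sum_eq_single (remV hn w)]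
  · exact remProj_ξ_of_eq rfl
  · exact fun v _ hv => diagProj_ξ_of_notMem fun H => hv (Subtype.ext H.symm)
  · simp

/-! ## The algebra `A(n)` -/

/-- `T_(e,w)` is itself a member of a periodic weighted shift: the weight is the indicator of the
paths `ew'` with `w'(n) = w`, and the operators of all other edges are zero. -/
theorem shiftOp_mem (p : (E.power n).Edge) : shiftOp p ∈ shiftAlg E n := by
  classical
  refine StarSubalgebra.le_topologicalClosure _ (StarAlgebra.subset_adjoin ℂ _ ?_)
  refine ⟨fun v => if ∃ w h, v = Path.cons p.1.1 w h ∧ w.rem n = p.1.2.1 then 1 else 0,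
    fun e => if e = p.1.1 then shiftOp p else 0, p.1.1, ?_, ?_, (if_pos rfl).symm⟩
  · intro e w
    beta_reduce
    by_cases he : e = p.1.1
    · subst he
      rw [if_pos rfl, isShiftOp_shiftOp p w]
      by_cases hw : w.rem n = p.1.2.1
      · have h : E.s p.1.1 = w.range := by rw [p.2, ← hw, Path.range_rem]
        rw [dif_pos hw, dif_pos h, if_pos ⟨w, h, rfl, hw⟩, one_smul]
      · rw [dif_neg hw]
        split_ifs with h h1
        · obtain ⟨w', h', H, hw'⟩ := h1
          exact absurd ((Path.cons_inj.1 H).2 ▸ hw') hw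
        · rw [zero_smul]
        · rfl
    · rw [if_neg he]
      split_ifs with h h1
      · obtain ⟨w', h', H, hw'⟩ := h1
        exact absurd (Path.cons_inj.1 H).1 he
      · rw [zero_smul]; rfl
      · rfl
  · intro e w h
    have hrem : (w.rem n).rem n = w.rem n := Path.rem_rem dvd_rfl w
    refine if_congr ⟨?_, ?_⟩ rfl rfl
    · rintro ⟨w', h', H, hw'⟩
      obtain ⟨rfl, rfl⟩ := Path.cons_inj.1 H
      exact ⟨_, h'.trans (Path.range_rem n w).symm, rfl, hrem.trans hw'⟩
    · rintro ⟨w', h', H, hw'⟩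
      obtain ⟨rfl, rfl⟩ := Path.cons_inj.1 H
      exact ⟨_, h, rfl, hrem.symm.trans hw'⟩

/-- Without sinks some edge `p` leaves `v`, and `Q_v = T_p* T_p`. -/
theorem remProj_mem (hn : 0 < n) (hE : E.NoSinks) (v : (E.power n).Vertex) :
    remProj v ∈ shiftAlg E n := by
  obtain ⟨p, rfl⟩ := power_noSinks hE v
  rw [← star_shiftOp_mul_self hn]
  exact mul_mem (star_mem (shiftOp_mem p)) (shiftOp_mem p)

theorem tailProj_mem (hn : 0 < n) (N : ℕ) : tailProj E N ∈ shiftAlg E n := by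
  have := Fintype.ofFinite (E.power n).Edge
  induction N with
  | zero => rw [tailProj_zero]; exact one_mem _
  | succ N ih =>
    rw [tailProj_succ hn]
    exact sum_mem fun p _ => mul_mem (mul_mem (shiftOp_mem p) ih) (star_mem (shiftOp_mem p))

/-- Periodic weighted shifts are linear combinations of the operators `T_(e,w)`. -/
theorem periodicShiftOps_subset_span (hn : 0 < n) :
    periodicShiftOps E n ⊆ Submodule.span ℂ (Set.range (shiftOp (E := E) (n := n))) := by
  classical
  have := Fintype.ofFinite (E.power n).Edge
  rintro _ ⟨lam, T, e, hT, hlam, rfl⟩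
  -- A periodic weight is determined by its values on `ew` with `|w| < n`, and these serve as the
  -- coefficients.
  have : T e = ∑ p : (E.power n).Edge,
      (if p.1.1 = e then lam (p.1.2.1.cons p.1.1 p.2) else 0) • shiftOp p := by
    refine pathOp_ext fun w => ?_
    rw [hT, _root_.sum_apply]
    split_ifs with h
    · rw [Finset.sum_eq_single (remE hn e w h)]
      · change _ = (if e = e then lam ((w.rem n).cons e _) else 0) • shiftOp _ (ξ w)
        rw [shiftOp_remE_ξ, if_pos rfl, hlam]
      · intro p _ hp
        change (if p.1.1 = e then lam (p.1.2.1.cons p.1.1 p.2) else 0) • shiftOp p (ξ w) = 0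
        split_ifs with he
        · rw [shiftOp_ξ_of_ne, smul_zero]
          exact fun H => hp (power_ext he H.symm)
        · rw [zero_smul]
      · simp
    · refine (Finset.sum_eq_zero fun p _ => ?_).symm
      change (if p.1.1 = e then lam (p.1.2.1.cons p.1.1 p.2) else 0) • shiftOp p (ξ w) = 0
      split_ifs with he
      · rw [shiftOp_ξ_of_ne, smul_zero]
        exact fun H => h (by rw [← he, p.2, ← H, Path.range_rem])
      · rw [zero_smul]
  rw [this]
  exact Submodule.sum_mem _ fun p _ => Submodule.smul_mem _ _ (Submodule.subset_span ⟨p, rfl⟩)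

end GraphAlg

end

noncomputable section
namespace GraphAlg

open FiniteGraph Filter Topology

variable {E : FiniteGraph.{u}} {n : ℕ}

/-! ## Compact operators -/

theorem norm_diagProj_le (D : Set E.Path) : ‖diagProj D‖ ≤ 1 :=
  (isStarProjection_diagProj D).norm_le

/-- The projection onto the span of finitely many basis vectors is compact. -/
theorem isCompactOperator_diagProj {D : Set E.Path} (hD : D.Finite) :
    IsCompactOperator (diagProj D) := by
  classical
  have := hD.fintype
  have h1 : diagProj D = ∑ w ∈ hD.toFinset, InnerProductSpace.rankOne ℂ (ξ w) (ξ w) := by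
    refine pathOp_ext fun v => ?_
    rw [_root_.sum_apply]
    simp only [InnerProductSpace.rankOne_apply, inner_ξ_left]
    by_cases hv : v ∈ D
    · rw [diagProj_ξ_of_mem hv, Finset.sum_eq_single v, ξ_apply_self, one_smul]
      · intro w _ hw
        rw [ξ_apply_of_ne hw, zero_smul]
      · simp [hv]
    · rw [diagProj_ξ_of_notMem hv, Finset.sum_eq_zero]
      intro w hw
      rw [ξ_apply_of_ne, zero_smul]
      rintro rfl
      exact hv (hD.mem_toFinset.1 hw)
  have h2 (w : E.Path) : IsCompactOperator (InnerProductSpace.rankOne ℂ (ξ w) (ξ w) :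
      PathOp E) := by
    have : IsCompactOperator (id : ℂ → ℂ) := isCompactOperator_id
    exact (this.comp_clm (innerSL ℂ (ξ w : PathSpace E))).clm_comp
      (ContinuousLinearMap.toSpanSingleton ℂ (ξ w : PathSpace E))
  rw [h1]
  exact Submodule.sum_mem (compactOperator (RingHom.id ℂ) (PathSpace E) (PathSpace E))
    fun w _ => h2 w

theorem one_sub_tailProj (N : ℕ) : 1 - tailProj E N = diagProj {w | w.length < N} := by
  refine pathOp_ext fun w => ?_
  change ξ w - tailProj E N (ξ w) = _
  by_cases h : N ≤ w.length
  · rw [tailProj_ξ_of_le h, diagProj_ξ_of_notMem (D := {w | w.length < N}) (not_lt.2 h),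
      sub_self]
  · rw [tailProj_ξ_of_lt (not_le.1 h), diagProj_ξ_of_mem (D := {w | w.length < N}) (not_le.1 h),
      sub_zero]

theorem isCompactOperator_one_sub_tailProj (N : ℕ) :
    IsCompactOperator (1 - tailProj E N : PathOp E) := by
  rw [one_sub_tailProj]
  exact isCompactOperator_diagProj (Set.finite_coe_iff.1 (Path.finite_length_lt N))

/-- A finite combination of basis vectors is eventually killed, and the tail projections are
contractions. -/
theorem tendsto_tailProj_apply (x : PathSpace E) :
    Tendsto (fun N => tailProj E N x) atTop (𝓝 0) := by
  classical
  have hx : HasSum (fun w => lp.single 2 w (x w)) x := lp.hasSum_single ENNReal.ofNat_ne_top x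
  have hs : ∀ w, (lp.single 2 w (x w) : PathSpace E) = x w • ξ w := by
    intro w
    unfold ξ
    rw [← lp.single_smul, smul_eq_mul, mul_one]
  simp_rw [hs] at hx
  rw [Metric.tendsto_atTop]
  intro ε hε
  obtain ⟨s, hs⟩ := ((Metric.tendsto_nhds.1 hx) ε hε).exists
  obtain ⟨M, hM⟩ : ∃ M, ∀ w ∈ s, w.length < M :=
    ⟨s.sup Path.length + 1, fun w hw => Nat.lt_succ_of_le (Finset.le_sup hw)⟩
  refine ⟨M, fun N hN => ?_⟩
  have h0 : tailProj E N (∑ w ∈ s, x w • ξ w) = 0 := by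
    rw [map_sum]
    refine Finset.sum_eq_zero fun w hw => ?_
    rw [map_smul, tailProj_ξ_of_lt ((hM w hw).trans_le hN), smul_zero]
  rw [dist_zero_right]
  calc ‖tailProj E N x‖ = ‖tailProj E N (x - ∑ w ∈ s, x w • ξ w)‖ := by rw [map_sub, h0, sub_zero]
    _ ≤ 1 * ‖x - ∑ w ∈ s, x w • ξ w‖ := (tailProj E N).le_of_opNorm_le (norm_diagProj_le _) _
    _ < ε := by rw [one_mul, ← dist_eq_norm, dist_comm]; exact hs

/-- Strong convergence of contractions is uniform on the totally bounded image of the unit ball. A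
finite `ε/4`-net costs `ε/4` for the distance to the net and `ε/4` for the tails of its points. -/
theorem tendsto_tailProj_mul {K : PathOp E} (hK : IsCompactOperator K) :
    Tendsto (fun N => ‖tailProj E N * K‖) atTop (𝓝 0) := by
  rw [Metric.tendsto_atTop]
  intro ε hε
  have htb : TotallyBounded (K '' Metric.closedBall 0 1) :=
    ((isCompactOperator_iff_isCompact_closure_image_closedBall (K : PathSpace E →ₗ[ℂ] PathSpace E)
      one_pos).1 hK).totallyBounded.subset subset_closure
  obtain ⟨t, htfin, htcov⟩ := Metric.totallyBounded_iff.1 htb (ε / 4) (by positivity)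
  have hev : ∀ᶠ N in atTop, ∀ y ∈ t, ‖tailProj E N y‖ < ε / 4 :=
    (eventually_all_finite htfin).2 fun y _ => by
      have := (tendsto_tailProj_apply y).norm
      rw [norm_zero] at this
      exact this.eventually_lt_const (by positivity)
  obtain ⟨M, hM⟩ := eventually_atTop.1 hev
  refine ⟨M, fun N hN => ?_⟩
  rw [dist_zero_right, norm_norm]
  refine lt_of_le_of_lt (ContinuousLinearMap.opNorm_le_of_unit_norm (C := ε / 2) (by positivity)
    fun x hx => ?_) (half_lt_self hε)
  obtain ⟨y, hy, hxy⟩ := Set.mem_iUnion₂.1 (htcov ⟨x, by simp [hx], rfl⟩)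
  rw [mem_ball_iff_norm] at hxy
  calc ‖tailProj E N (K x)‖ = ‖tailProj E N (K x - y) + tailProj E N y‖ := by
        rw [map_sub, sub_add_cancel]
    _ ≤ 1 * ‖K x - y‖ + ‖tailProj E N y‖ :=
        (norm_add_le _ _).trans (add_le_add_left
          ((tailProj E N).le_of_opNorm_le (norm_diagProj_le _) _) _)
    _ ≤ ε / 2 := by linarith [hM N hN y hy]

theorem tendsto_mul_tailProj {K : PathOp E} (hK : IsCompactOperator K) :
    Tendsto (fun N => ‖K * tailProj E N‖) atTop (𝓝 0) := by
  have h := tendsto_tailProj_mul (isCompactOperator_star hK)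
  refine h.congr fun N => ?_
  rw [← norm_star, star_mul, star_star, tailProj, star_diagProj]

theorem sum_startProj [Fintype E.Vertex] : ∑ x : E.Vertex, startProj E x = 1 := by
  refine pathOp_ext fun w => ?_
  rw [_root_.sum_apply, Finset.sum_eq_single w.start]
  · exact startProj_ξ_of_eq rfl
  · exact fun x _ hx => startProj_ξ_of_ne (Ne.symm hx)
  · simp

theorem startProj_mul_self (x : E.Vertex) : startProj E x * startProj E x = startProj E x :=
  (Submodule.isIdempotentElem_starProjection _)

/-- The elements of `A(n)` are block-diagonal. -/
theorem mem_blockCompacts_iff {a : PathOp E} (ha : a ∈ shiftAlg E n) :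
    a ∈ blockCompacts E ↔ IsCompactOperator a := by
  have := Fintype.ofFinite E.Vertex
  refine ⟨fun h => h.1, fun h => ⟨h, ?_⟩⟩
  rw [finsum_eq_sum_of_fintype]
  -- Since `a` commutes with each `R_x`, the block-diagonal part of `a` is `a ∑ R_x = a`.
  simp_rw [startProj_comm ha, mul_assoc, startProj_mul_self]
  rw [← Finset.mul_sum, sum_startProj, mul_one]

theorem mem_compactIdeal_iff {a : shiftAlg E n} :
    a ∈ compactIdeal E n ↔ IsCompactOperator (a : PathOp E) :=
  mem_blockCompacts_iff a.2

theorem isClosed_compactIdeal : IsClosed (compactIdeal E n : Set (shiftAlg E n)) := by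
  have h : (compactIdeal E n : Set (shiftAlg E n)) =
      Subtype.val ⁻¹' {K : PathOp E | IsCompactOperator K} :=
    Set.ext fun a => mem_compactIdeal_iff
  rw [h]
  exact isClosed_setOfPred_isCompactOperator.preimage continuous_subtype_val

instance : IsClosed ((compactIdeal E n : Submodule (shiftAlg E n) (shiftAlg E n)) :
    Set (shiftAlg E n)) := isClosed_compactIdeal

/-! ## The quotient `B(n)` is a C*-algebra -/

instance : NormedAddCommGroup (quotAlg E n) :=
  inferInstanceAs (NormedAddCommGroup (shiftAlg E n ⧸ compactIdeal E n))

instance : CompleteSpace (shiftAlg E n) :=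
  (StarSubalgebra.isClosed_topologicalClosure _).completeSpace_coe

instance : CompleteSpace (quotAlg E n) :=
  inferInstanceAs (CompleteSpace (shiftAlg E n ⧸ compactIdeal E n))

theorem norm_toQuot_le (a : shiftAlg E n) : ‖toQuot E n a‖ ≤ ‖a‖ :=
  Submodule.Quotient.norm_mk_le (compactIdeal E n) a

theorem exists_toQuot_eq_norm_lt (x : quotAlg E n) {ε : ℝ} (hε : 0 < ε) :
    ∃ a, toQuot E n a = x ∧ ‖a‖ < ‖x‖ + ε :=
  Submodule.Quotient.norm_mk_lt (S := compactIdeal E n) x hε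

/-- Cutting off finitely many basis vectors changes `a` by a compact element of `A(n)`, so the class
is unchanged. -/
theorem norm_toQuot_le_norm_mul_tailProj (hn : 0 < n) (a : shiftAlg E n) (N : ℕ) :
    ‖toQuot E n a‖ ≤ ‖(a : PathOp E) * tailProj E N‖ := by
  have h : toQuot E n a = toQuot E n (a * ⟨tailProj E N, tailProj_mem hn N⟩) := by
    rw [← sub_eq_zero, ← map_sub, toQuot_eq_zero, mem_blockCompacts_iff (SetLike.coe_mem _)]
    have h1 := (isCompactOperator_one_sub_tailProj (E := E) N).clm_comp (a : PathOp E)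
    have h2 : ((a - a * ⟨tailProj E N, tailProj_mem hn N⟩ : shiftAlg E n) : PathOp E) =
        (a : PathOp E) * (1 - tailProj E N) := by
      rw [mul_sub, mul_one]; rfl
    rw [h2]
    exact h1
  rw [h]
  exact norm_toQuot_le _

/-- For the upper bound compare `a` with a nearly minimal representative `b`: the tail of the
compact `a - b` tends to `0`. This turns the quotient norm into a limit of operator norms. -/
theorem tendsto_norm_mul_tailProj (hn : 0 < n) (a : shiftAlg E n) :
    Tendsto (fun N => ‖(a : PathOp E) * tailProj E N‖) atTop (𝓝 ‖toQuot E n a‖) := by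
  rw [Metric.tendsto_atTop]
  intro ε hε
  obtain ⟨b, hb, hbn⟩ := exists_toQuot_eq_norm_lt (toQuot E n a) (half_pos hε)
  have hK : IsCompactOperator ((a - b : shiftAlg E n) : PathOp E) := by
    rw [← mem_compactIdeal_iff]
    exact (mem_blockCompacts_iff (SetLike.coe_mem _)).2 (toQuot_eq_zero.1 (by
      rw [map_sub, hb, sub_self])).1
  obtain ⟨M, hM⟩ := eventually_atTop.1
    ((tendsto_mul_tailProj hK).eventually_lt_const (half_pos hε))
  refine ⟨M, fun N hN => ?_⟩
  have h1 := norm_toQuot_le_norm_mul_tailProj hn a N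
  have h2 : ‖(a : PathOp E) * tailProj E N‖ ≤
      ‖((a - b : shiftAlg E n) : PathOp E) * tailProj E N‖ + ‖(b : PathOp E)‖ * 1 := by
    calc _ = ‖((a - b : shiftAlg E n) : PathOp E) * tailProj E N +
          (b : PathOp E) * tailProj E N‖ := by
          rw [← add_mul]; simp
      _ ≤ _ := (norm_add_le _ _).trans (add_le_add_right ((norm_mul_le _ _).trans
          (mul_le_mul_of_nonneg_left (norm_diagProj_le _) (norm_nonneg _))) _)
  have h3 := hM N hN
  rw [Real.dist_eq, abs_of_nonneg (sub_nonneg.2 h1)]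
  have h4 : ‖(b : PathOp E)‖ = ‖b‖ := rfl
  linarith

theorem norm_quotAlg_mul_le (x y : quotAlg E n) : ‖x * y‖ ≤ ‖x‖ * ‖y‖ := by
  have h : ∀ᶠ ε in 𝓝[>] (0 : ℝ), ‖x * y‖ ≤ (‖x‖ + ε) * (‖y‖ + ε) := by
    filter_upwards [self_mem_nhdsWithin] with ε hε
    obtain ⟨a, rfl, ha⟩ := exists_toQuot_eq_norm_lt x hε
    obtain ⟨b, rfl, hb⟩ := exists_toQuot_eq_norm_lt y hε
    rw [← map_mul]
    exact (norm_toQuot_le _).trans ((norm_mul_le a b).trans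
      (mul_le_mul ha.le hb.le (norm_nonneg _) ((norm_nonneg _).trans ha.le)))
  have hc : Continuous fun ε : ℝ => (‖x‖ + ε) * (‖y‖ + ε) := by fun_prop
  have := (hc.tendsto 0).mono_left (nhdsWithin_le_nhds (s := Set.Ioi 0))
  rw [add_zero, add_zero] at this
  exact ge_of_tendsto this h

/-- With `Q` a tail projection, `‖aQ‖² = ‖Q a*a Q‖ ≤ ‖a*a Q‖`; both sides pass to the limit. -/
theorem norm_quotAlg_mul_self_le (hn : 0 < n) (x : quotAlg E n) :
    ‖x‖ * ‖x‖ ≤ ‖star x * x‖ := by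
  obtain ⟨a, rfl⟩ := toQuot_surjective E n x
  rw [← map_star, ← map_mul]
  have h := tendsto_norm_mul_tailProj hn a
  refine le_of_tendsto_of_tendsto' (h.mul h) (tendsto_norm_mul_tailProj hn (star a * a))
    fun N => ?_
  rw [← CStarRing.norm_star_mul_self, star_mul, mul_assoc, ← mul_assoc (star (a : PathOp E))]
  refine (norm_mul_le _ _).trans ?_
  rw [tailProj, star_diagProj]
  exact mul_le_of_le_one_left (norm_nonneg _) (norm_diagProj_le _)

theorem norm_quotAlg_smul_le (c : ℂ) (x : quotAlg E n) : ‖c • x‖ ≤ ‖c‖ * ‖x‖ := by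
  have h : ∀ᶠ ε in 𝓝[>] (0 : ℝ), ‖c • x‖ ≤ ‖c‖ * (‖x‖ + ε) := by
    filter_upwards [self_mem_nhdsWithin] with ε hε
    obtain ⟨a, rfl, ha⟩ := exists_toQuot_eq_norm_lt x hε
    rw [← map_smul]
    exact (norm_toQuot_le _).trans ((norm_smul_le c a).trans
      (mul_le_mul_of_nonneg_left ha.le (norm_nonneg _)))
  have hc : Continuous fun ε : ℝ => ‖c‖ * (‖x‖ + ε) := by fun_prop
  have := (hc.tendsto 0).mono_left (nhdsWithin_le_nhds (s := Set.Ioi 0))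
  rw [add_zero] at this
  exact ge_of_tendsto this h

/-- Positivity of `n` enters through the C*-inequality, and is a class argument so that instance
resolution can find it. -/
instance [NeZero n] : NonUnitalCStarAlgebra (quotAlg E n) where
  __ := (inferInstance : NormedAddCommGroup (quotAlg E n))
  __ := (inferInstance : Ring (quotAlg E n))
  __ := (inferInstance : StarRing (quotAlg E n))
  __ := (inferInstance : CompleteSpace (quotAlg E n))
  __ := (Algebra.toModule : Module ℂ (quotAlg E n))
  dist_eq := dist_eq_norm_neg_add
  norm_mul_le := norm_quotAlg_mul_le
  norm_mul_self_le := norm_quotAlg_mul_self_le (NeZero.pos n)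
  norm_smul_le := norm_quotAlg_smul_le
  smul_assoc c x y := smul_mul_assoc c x y
  smul_comm c x y := (mul_smul_comm c x y).symm
  star_smul c x := by
    obtain ⟨a, rfl⟩ := toQuot_surjective E n x
    rw [← map_smul, ← map_star, star_smul, map_smul, map_star]

end GraphAlg

end

noncomputable section

theorem finsum_subtype_eq_sum_filter {ι M : Type*} [AddCommMonoid M] [Fintype ι] (p : ι → Prop)
    [DecidablePred p] (f : ι → M) : ∑ᶠ i : {i // p i}, f i = ∑ i with p i, f i := by
  rw [finsum_eq_sum_of_fintype]
  exact (Finset.sum_subtype _ (by simp) f).symm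

namespace GraphAlg

open FiniteGraph Filter Topology

variable {E : FiniteGraph.{u}} {n : ℕ}

/-! ## The Cuntz-Krieger `E(n)`-family in `B(n)` -/

/-- The class of `T_(e,w)` in `B(n)`. -/
def shiftClass (p : (E.power n).Edge) : quotAlg E n := toQuot E n ⟨shiftOp p, shiftOp_mem p⟩

/-- The class of `Q_w` in `B(n)`. -/
def remClass (hn : 0 < n) (hE : E.NoSinks) (v : (E.power n).Vertex) : quotAlg E n :=
  toQuot E n ⟨remProj v, remProj_mem hn hE v⟩

/-- All relations but the last hold already for operators; the last has the compact defect `Q_v (1 -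
tailProj E 1)`. -/
theorem isCKFamily_classes (hn : 0 < n) (hE : E.NoSinks) :
    IsCKFamily (E.power n) (remClass hn hE) (shiftClass (E := E) (n := n)) where
  isStarProjection v := by
    have h : IsStarProjection (⟨remProj v, remProj_mem hn hE v⟩ : shiftAlg E n) :=
      ⟨Subtype.ext (isStarProjection_diagProj _).isIdempotentElem,
        Subtype.ext (isStarProjection_diagProj _).isSelfAdjoint⟩
    exact h.map (toQuot E n)
  orthogonal v w h := by
    rw [remClass, remClass, ← map_mul]
    refine (congrArg (toQuot E n) (Subtype.ext ?_)).trans (map_zero _)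
    refine diagProj_mul_of_disjoint (Set.disjoint_left.2 fun u hu hu' => h (Subtype.ext ?_))
    exact hu.symm.trans hu'
  star_mul_of_ne p q h := by
    rw [shiftClass, shiftClass, ← map_star, ← map_mul]
    exact (congrArg (toQuot E n) (Subtype.ext (star_shiftOp_mul_shiftOp_of_ne hn h))).trans
      (map_zero _)
  star_mul_self p := by
    rw [shiftClass, remClass, ← map_star, ← map_mul]
    exact congrArg (toQuot E n) (Subtype.ext (star_shiftOp_mul_self hn p))
  sum_mul_star v _ := by
    classical
    have := Fintype.ofFinite (E.power n).Edge
    have hsum : ∑ p : (E.power n).Edge with (E.power n).r p = v,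
        shiftClass p * star (shiftClass p) = toQuot E n
          (⟨remProj v, remProj_mem hn hE v⟩ * ⟨tailProj E 1, tailProj_mem hn 1⟩) := by
      simp_rw [shiftClass, ← map_star, ← map_mul]
      rw [← map_sum]
      refine congrArg (toQuot E n) (Subtype.ext ?_)
      rw [AddSubmonoidClass.coe_finsetSum]
      exact (remProj_mul_tailProj_one hn v).symm
    rw [finsum_subtype_eq_sum_filter (fun p => (E.power n).r p = v)
      fun p => shiftClass p * star (shiftClass p), hsum, remClass, eq_comm, ← sub_eq_zero, ← map_sub,
      toQuot_eq_zero, mem_blockCompacts_iff (SetLike.coe_mem _)]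
    have h2 : ((⟨remProj v, remProj_mem hn hE v⟩ - ⟨remProj v, remProj_mem hn hE v⟩ *
        ⟨tailProj E 1, tailProj_mem hn 1⟩ : shiftAlg E n) : PathOp E) =
        remProj v * (1 - tailProj E 1) := by
      rw [mul_sub, mul_one]; rfl
    rw [h2]
    exact (isCompactOperator_one_sub_tailProj 1).clm_comp (remProj v)

/-- The canonical homomorphism `O(E(n)) → B(n)`. -/
theorem exists_canonicalHom [NeZero n] (hE : E.NoSinks) :
    ∃ φ : CK (E.power n) →⋆ₙₐ[ℂ] quotAlg E n,
      (∀ v, φ (CK.P (E.power n) v) = remClass (NeZero.pos n) hE v) ∧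
      ∀ p, φ (CK.S (E.power n) p) = shiftClass p :=
  CK.exists_lift _ _ (isCKFamily_classes (NeZero.pos n) hE)

end GraphAlg

end

noncomputable section
namespace GraphAlg

open FiniteGraph Filter Topology

variable {E : FiniteGraph.{u}} {n : ℕ}

/-! ## Cuntz-Krieger families -/

section CKFamily

variable {F : FiniteGraph.{u}} {A : Type*} [NonUnitalCStarAlgebra A] {P : F.Vertex → A}
  {S : F.Edge → A}

theorem IsCKFamily.S_mul_P (h : IsCKFamily F P S) (e : F.Edge) : S e * P (F.s e) = S e := by
  have h1 := (h.isStarProjection (F.s e)).isIdempotentElem.eq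
  have h2 := (h.isStarProjection (F.s e)).isSelfAdjoint.star_eq
  rw [← sub_eq_zero, ← CStarRing.star_mul_self_eq_zero_iff]
  simp only [star_sub, star_mul, h2, sub_mul, mul_sub]
  simp only [mul_assoc, ← mul_assoc (star (S e)), h.star_mul_self, h1, sub_self]

theorem IsCKFamily.S_mul_P_of_ne (h : IsCKFamily F P S) {e : F.Edge} {x : F.Vertex}
    (hx : F.s e ≠ x) : S e * P x = 0 := by
  rw [← h.S_mul_P, mul_assoc, h.orthogonal _ _ hx, mul_zero]

theorem IsCKFamily.sum_filter_mul_star (h : IsCKFamily F P S) [Fintype F.Edge]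
    [DecidableEq F.Vertex] (hF : F.NoSources) (x : F.Vertex) :
    ∑ e : F.Edge with F.r e = x, S e * star (S e) = P x := by
  rw [← h.sum_mul_star x (hF x), finsum_subtype_eq_sum_filter (fun e => F.r e = x)
    fun e => S e * star (S e)]

theorem IsCKFamily.P_mul_S (h : IsCKFamily F P S) (e : F.Edge) : P (F.r e) * S e = S e := by
  classical
  have := Fintype.ofFinite F.Edge
  rw [← h.sum_mul_star _ ⟨e, rfl⟩, finsum_subtype_eq_sum_filter (fun f => F.r f = F.r e)
    fun e => S e * star (S e), Finset.sum_mul, Finset.sum_eq_single e]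
  · rw [mul_assoc, h.star_mul_self, h.S_mul_P]
  · intro f _ hf
    rw [mul_assoc, h.star_mul_of_ne _ _ hf, mul_zero]
  · simp

theorem IsCKFamily.isStarProjection_sum (h : IsCKFamily F P S) (s : Finset F.Vertex) :
    IsStarProjection (∑ x ∈ s, P x) := by
  classical
  refine ⟨?_, ?_⟩
  · rw [IsIdempotentElem, Finset.sum_mul_sum]
    refine Finset.sum_congr rfl fun x hx => ?_
    rw [Finset.sum_eq_single x]
    · exact (h.isStarProjection x).isIdempotentElem
    · exact fun y _ hy => h.orthogonal _ _ hy.symm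
    · exact fun H => absurd hx H
  · rw [IsSelfAdjoint, star_sum]
    exact Finset.sum_congr rfl fun x _ => (h.isStarProjection x).isSelfAdjoint

end CKFamily

/-! ## The elements `S_w` of a Cuntz-Krieger `E(n)`-family, for paths `w` of `E` -/

section PathElem

variable {A : Type*} [NonUnitalCStarAlgebra A]

/-- The product of the generators along the lift to `E(n)` of the walk `l` starting at `x`. -/
def walkElem (hn : 0 < n) (P : (E.power n).Vertex → A) (S : (E.power n).Edge → A) (x : E.Vertex) :
    (l : List E.Edge) → E.IsWalk x l → A
  | [], _ => P (remV hn (Path.vertex x))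
  | e :: l, h => S (remE hn e ⟨x, l, h.2⟩ h.1) * walkElem hn P S x l h.2

/-- The product of the generators along the lift to `E(n)` of the path `w` of `E`. -/
def pathElem (hn : 0 < n) (P : (E.power n).Vertex → A) (S : (E.power n).Edge → A) (w : E.Path) : A :=
  walkElem hn P S w.start w.edges w.isWalk

variable {hn : 0 < n} {P : (E.power n).Vertex → A} {S : (E.power n).Edge → A}

theorem pathElem_vertex (x : E.Vertex) :
    pathElem hn P S (Path.vertex x) = P (remV hn (Path.vertex x)) := rfl

theorem pathElem_cons (e : E.Edge) (w : E.Path) (h : E.s e = w.range) :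
    pathElem hn P S (w.cons e h) = S (remE hn e w h) * pathElem hn P S w := rfl

variable (hCK : IsCKFamily (E.power n) P S)
include hCK

theorem P_mul_pathElem (w : E.Path) : P (remV hn w) * pathElem hn P S w = pathElem hn P S w := by
  obtain ⟨x, rfl⟩ | ⟨e, w, h, rfl⟩ := w.eq_vertex_or_cons
  · exact (hCK.isStarProjection _).isIdempotentElem
  · rw [pathElem_cons, ← mul_assoc, ← power_r_remE, hCK.P_mul_S]

theorem S_mul_pathElem_of_ne {p : (E.power n).Edge} {w : E.Path} (h : w.rem n ≠ p.1.2.1) :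
    S p * pathElem hn P S w = 0 := by
  rw [← P_mul_pathElem hCK, ← mul_assoc, hCK.S_mul_P_of_ne, zero_mul]
  exact fun H => h (congrArg Subtype.val H).symm

theorem star_S_mul_pathElem_cons (e : E.Edge) (w : E.Path) (h : E.s e = w.range) :
    star (S (remE hn e w h)) * pathElem hn P S (w.cons e h) = pathElem hn P S w := by
  rw [pathElem_cons, ← mul_assoc, hCK.star_mul_self, power_s_remE, P_mul_pathElem hCK]

theorem star_S_mul_pathElem_cons_of_ne {p : (E.power n).Edge} {e : E.Edge} {w : E.Path}
    {h : E.s e = w.range} (hp : p ≠ remE hn e w h) :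
    star (S p) * pathElem hn P S (w.cons e h) = 0 := by
  rw [pathElem_cons, ← mul_assoc, hCK.star_mul_of_ne _ _ hp, zero_mul]

end PathElem

/-! ## Finite sets of paths -/

/-- The finite set of paths of length in `[a, b)`. -/
def pathsIco (E : FiniteGraph.{u}) (a b : ℕ) : Finset E.Path :=
  Set.Finite.toFinset (s := {w : E.Path | a ≤ w.length ∧ w.length < b})
    ((Set.finite_coe_iff.1 (Path.finite_length_lt b)).subset fun _ h => h.2)

@[simp] theorem mem_pathsIco {a b : ℕ} {w : E.Path} :
    w ∈ pathsIco E a b ↔ a ≤ w.length ∧ w.length < b := by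
  simp [pathsIco]

theorem sum_pathsIco_consecutive {M : Type*} [AddCommMonoid M] (f : E.Path → M) {a b c : ℕ}
    (hab : a ≤ b) (hbc : b ≤ c) :
    ∑ w ∈ pathsIco E a b, f w + ∑ w ∈ pathsIco E b c, f w = ∑ w ∈ pathsIco E a c, f w := by
  classical
  rw [← Finset.sum_union]
  · refine Finset.sum_congr (Finset.ext fun w => ?_) fun _ _ => rfl
    simp only [Finset.mem_union, mem_pathsIco]
    omega
  · refine Finset.disjoint_left.2 fun w h h' => ?_
    simp only [mem_pathsIco] at h h'
    omega

open Classical in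
/-- The path `e w'` for `p = (e, w)`, where `w'(n) = w`. -/
def consEdge (p : (E.power n).Edge) (w : E.Path) : E.Path :=
  if h : E.s p.1.1 = w.range then w.cons p.1.1 h else w

theorem s_eq_range {p : (E.power n).Edge} {w : E.Path} (h : w.rem n = p.1.2.1) :
    E.s p.1.1 = w.range := by rw [p.2, ← h, Path.range_rem]

theorem consEdge_eq {p : (E.power n).Edge} {w : E.Path} (h : w.rem n = p.1.2.1) :
    consEdge p w = w.cons p.1.1 (s_eq_range h) := dif_pos _

open Classical in
/-- Reindexing of a sum over paths whose last edge lifts to `p`. -/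
theorem sum_pathsIco_consEdge {M : Type*} [AddCommMonoid M] (p : (E.power n).Edge)
    (f : E.Path → M) (a b : ℕ)
    (hf : ∀ (hn : 0 < n) e w h, f (Path.cons e w h) ≠ 0 → p = remE hn e w h) :
    ∑ w ∈ pathsIco E (a + 1) (b + 1), f w =
      ∑ w ∈ pathsIco E a b with w.rem n = p.1.2.1, f (consEdge p w) := by
  have hn : 0 < n := Nat.lt_of_le_of_lt (Nat.zero_le _) p.1.2.2
  symm
  -- Only nonzero terms need a preimage, and these are indexed by some `ew` that lifts to `p`;
  -- trivial paths are excluded by `a + 1`.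
  refine Finset.sum_bij_ne_zero (fun w _ _ => consEdge p w) ?_ ?_ ?_ ?_
  · intro w hw _
    rw [Finset.mem_filter, mem_pathsIco] at hw
    rw [consEdge_eq hw.2, mem_pathsIco, Path.length_cons]
    omega
  · intro w hw _ w' hw' _ H
    rw [consEdge_eq (Finset.mem_filter.1 hw).2, consEdge_eq (Finset.mem_filter.1 hw').2] at H
    exact (Path.cons_inj.1 H).2
  · intro w hw hw0
    obtain ⟨x, rfl⟩ | ⟨e, w, h, rfl⟩ := w.eq_vertex_or_cons
    · rw [mem_pathsIco, Path.length_vertex] at hw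
      omega
    · obtain rfl := hf hn e w h hw0
      have h1 : w.rem n = (remE hn e w h).1.2.1 := rfl
      have h2 : consEdge (remE hn e w h) w = w.cons e h := consEdge_eq h1
      rw [mem_pathsIco, Path.length_cons] at hw
      refine ⟨w, Finset.mem_filter.2 ⟨mem_pathsIco.2 (by omega), h1⟩, ?_, h2⟩
      rwa [h2]
  · exact fun _ _ _ => rfl

end GraphAlg

end

noncomputable section
namespace GraphAlg

open FiniteGraph Filter Topology

variable {E : FiniteGraph.{u}} {n : ℕ}

/-! ### Coordinates of shifted vectors -/

theorem eq_remE (hn : 0 < n) {p : (E.power n).Edge} {w : E.Path} (h : w.rem n = p.1.2.1) :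
    p = remE hn p.1.1 w (s_eq_range h) := power_ext rfl h.symm

/-- Coordinates of `T y` for arbitrary `y` are read off from the adjoint on basis vectors, with no
series expansion of `y`. -/
theorem apply_apply_eq_inner (T : PathOp E) (y : PathSpace E) (v : E.Path) :
    T y v = inner ℂ ((star T : PathOp E) (ξ v)) y := by
  rw [ContinuousLinearMap.star_eq_adjoint, ContinuousLinearMap.adjoint_inner_left, inner_ξ_left]

theorem shiftOp_remE_apply_cons (hn : 0 < n) (e : E.Edge) (w : E.Path) (h : E.s e = w.range)
    (y : PathSpace E) : shiftOp (remE hn e w h) y (w.cons e h) = y w := by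
  rw [apply_apply_eq_inner, star_shiftOp_remE_ξ_cons, inner_ξ_left]

theorem shiftOp_apply_cons_of_ne (hn : 0 < n) {p : (E.power n).Edge} {e : E.Edge}
    {w : E.Path} {h : E.s e = w.range} (hp : p ≠ remE hn e w h) (y : PathSpace E) :
    shiftOp p y (w.cons e h) = 0 := by
  rw [apply_apply_eq_inner, star_shiftOp_ξ_cons_of_ne hn hp, inner_zero_left]

theorem star_shiftOp_apply_of_ne {p : (E.power n).Edge} {w : E.Path} (h : w.rem n ≠ p.1.2.1)
    (y : PathSpace E) : (star (shiftOp p) : PathOp E) y w = 0 := by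
  rw [apply_apply_eq_inner, star_star, shiftOp_ξ_of_ne h, inner_zero_left]

theorem star_shiftOp_remE_apply (hn : 0 < n) (e : E.Edge) (w : E.Path) (h : E.s e = w.range)
    (y : PathSpace E) :
    (star (shiftOp (remE hn e w h)) : PathOp E) y w = y (w.cons e h) := by
  rw [apply_apply_eq_inner, star_star, shiftOp_remE_ξ, inner_ξ_left]

theorem tailProj_apply_of_le {N : ℕ} {w : E.Path} (h : N ≤ w.length) (y : PathSpace E) :
    tailProj E N y w = y w := by
  rw [apply_apply_eq_inner, tailProj, star_diagProj, diagProj_ξ_of_mem h, inner_ξ_left]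

/-! ## Compressions of operators on `ℓ²(E*)` by a Cuntz-Krieger `E(n)`-family -/

section Compress

variable {A : Type*} [NonUnitalCStarAlgebra A]

/-- The sum `∑ y(w) S_w` over a finite set of paths. -/
def pathComb (hn : 0 < n) (P : (E.power n).Vertex → A) (S : (E.power n).Edge → A)
    (I : Finset E.Path) (y : PathSpace E) : A := ∑ w ∈ I, y w • pathElem hn P S w

/-- The sum `∑ ⟨ξ_v, x ξ_w⟩ S_v S_w*` over `v ∈ I` and `w ∈ J`. -/
def compress (hn : 0 < n) (P : (E.power n).Vertex → A) (S : (E.power n).Edge → A)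
    (I J : Finset E.Path) (x : PathOp E) : A :=
  ∑ w ∈ J, pathComb hn P S I (x (ξ w)) * star (pathElem hn P S w)

variable {hn : 0 < n} {P : (E.power n).Vertex → A} {S : (E.power n).Edge → A}

theorem pathComb_sub (I : Finset E.Path) (y z : PathSpace E) :
    pathComb hn P S I (y - z) = pathComb hn P S I y - pathComb hn P S I z := by
  rw [pathComb, pathComb, pathComb, ← Finset.sum_sub_distrib]
  refine Finset.sum_congr rfl fun w _ => ?_
  rw [← sub_smul]; rfl

theorem compress_sub (I J : Finset E.Path) (x y : PathOp E) :
    compress hn P S I J (x - y) = compress hn P S I J x - compress hn P S I J y := by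
  rw [compress, compress, compress, ← Finset.sum_sub_distrib]
  refine Finset.sum_congr rfl fun w _ => ?_
  rw [← sub_mul, ← pathComb_sub]; rfl

theorem pathComb_consecutive {a b c : ℕ} (hab : a ≤ b) (hbc : b ≤ c) (y : PathSpace E) :
    pathComb hn P S (pathsIco E a b) y + pathComb hn P S (pathsIco E b c) y =
      pathComb hn P S (pathsIco E a c) y :=
  sum_pathsIco_consecutive _ hab hbc

theorem compress_consecutive {a b c : ℕ} (hab : a ≤ b) (hbc : b ≤ c) (J : Finset E.Path)
    (x : PathOp E) :
    compress hn P S (pathsIco E a b) J x + compress hn P S (pathsIco E b c) J x =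
      compress hn P S (pathsIco E a c) J x := by
  rw [compress, compress, compress, ← Finset.sum_add_distrib]
  refine Finset.sum_congr rfl fun w _ => ?_
  rw [← add_mul, pathComb_consecutive hab hbc]

theorem compress_tailProj_mul {a b N : ℕ} (h : N ≤ a) (J : Finset E.Path) (x : PathOp E) :
    compress hn P S (pathsIco E a b) J (tailProj E N * x) =
      compress hn P S (pathsIco E a b) J x := by
  refine Finset.sum_congr rfl fun w _ => congrArg (· * _) (Finset.sum_congr rfl fun v hv => ?_)
  change (tailProj E N (x (ξ w))) v • _ = _
  rw [tailProj_apply_of_le (h.trans (mem_pathsIco.1 hv).1)]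

theorem compress_one (I : Finset E.Path) :
    compress hn P S I I 1 = ∑ w ∈ I, pathElem hn P S w * star (pathElem hn P S w) := by
  refine Finset.sum_congr rfl fun w hw => congrArg (· * _) ?_
  change ∑ v ∈ I, (ξ w : PathSpace E) v • _ = _
  rw [Finset.sum_eq_single w, ξ_apply_self, one_smul]
  · intro v _ hv
    rw [ξ_apply_of_ne hv, zero_smul]
  · exact fun h => absurd hw h

theorem sum_norm_sq_apply_le (I : Finset E.Path) (y : PathSpace E) :
    ∑ w ∈ I, ‖y w‖ ^ 2 ≤ ‖y‖ ^ 2 := by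
  have h := lp.sum_rpow_le_norm_rpow (p := 2) (by norm_num) y I
  simpa using h

theorem norm_sq_sum_smul_ξ {J : Finset E.Path} (c : J → ℂ) :
    ‖∑ w : J, c w • (ξ w.1 : PathSpace E)‖ ^ 2 = ∑ w, ‖c w‖ ^ 2 := by
  have h : Orthonormal ℂ (fun w : J => (ξ w.1 : PathSpace E)) :=
    orthonormal_ξ.comp _ Subtype.val_injective
  have h2 := h.inner_sum c c Finset.univ
  rw [inner_self_eq_norm_sq_to_K] at h2
  have h3 : ((‖∑ w : J, c w • (ξ w.1 : PathSpace E)‖ ^ 2 : ℝ) : ℂ) =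
      ((∑ w, ‖c w‖ ^ 2 : ℝ) : ℂ) := by
    push_cast
    rw [← Complex.coe_algebraMap, h2]
    exact Finset.sum_congr rfl fun w _ => Complex.conj_mul' _
  exact Complex.ofReal_injective h3

/-- The norm of the sum `∑ S_w S_w*` over a finite set of paths. -/
def rangeNorm (hn : 0 < n) (P : (E.power n).Vertex → A) (S : (E.power n).Edge → A)
    (I : Finset E.Path) : ℝ := ‖∑ w ∈ I, pathElem hn P S w * star (pathElem hn P S w)‖

/-- The matrix of `x` between finite sets of basis vectors has norm at most `‖x‖`. Rows and columns
are kept apart because boundary terms have far fewer rows than columns. -/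
theorem norm_compress_sq_le (I J : Finset E.Path) (x : PathOp E) :
    ‖compress hn P S I J x‖ ^ 2 ≤ ‖x‖ ^ 2 * (rangeNorm hn P S I * rangeNorm hn P S J) := by
  have h := CStarAlgebra.norm_sum_sum_smul_mul_star_sq_le
    (Matrix.of fun (v : I) (w : J) => x (ξ w.1) v.1) ‖x‖ ?_
    (fun v : I => pathElem hn P S v.1) (fun w : J => pathElem hn P S w.1)
  · rw [Finset.sum_coe_sort I fun v => pathElem hn P S v * star (pathElem hn P S v),
      Finset.sum_coe_sort J fun v => pathElem hn P S v * star (pathElem hn P S v)] at h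
    refine Eq.trans_le (congrArg (fun z : A => ‖z‖ ^ 2) ?_) h
    rw [Finset.sum_comm, compress, ← Finset.sum_coe_sort J]
    refine Finset.sum_congr rfl fun w _ => ?_
    rw [pathComb, ← Finset.sum_coe_sort I, Finset.sum_mul]
    exact Finset.sum_congr rfl fun v _ => smul_mul_assoc _ _ _
  · intro c
    have h1 (v : I) : ∑ w : J, Matrix.of (fun (v : I) (w : J) => x (ξ w.1) v.1) v w * c w =
        x (∑ w : J, c w • (ξ w.1 : PathSpace E)) v.1 := by
      rw [map_sum, ← inner_ξ_left, inner_sum]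
      refine Finset.sum_congr rfl fun w _ => ?_
      rw [map_smul, inner_smul_right, inner_ξ_left, mul_comm]
      rfl
    simp_rw [h1]
    rw [← norm_sq_sum_smul_ξ c, ← mul_pow,
      Finset.sum_coe_sort I fun v => ‖x (∑ w : J, c w • (ξ w.1 : PathSpace E)) v‖ ^ 2]
    exact (sum_norm_sq_apply_le _ _).trans
      (pow_le_pow_left₀ (norm_nonneg _) (x.le_opNorm _) 2)

variable (hCK : IsCKFamily (E.power n) P S)
include hCK

/-- If `p` is the lifted edge at `w`, then `T_p y` has coordinate `y(w)` at `ew`, and `S_{ew} = S_p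
S_w`; otherwise `S_p S_w = 0`. The window of lengths moves by one. -/
theorem pathComb_shiftOp (p : (E.power n).Edge) (a b : ℕ) (y : PathSpace E) :
    pathComb hn P S (pathsIco E (a + 1) (b + 1)) (shiftOp p y) =
      S p * pathComb hn P S (pathsIco E a b) y := by
  classical
  rw [pathComb, sum_pathsIco_consEdge p, pathComb, Finset.mul_sum, Finset.sum_filter]
  · refine Finset.sum_congr rfl fun w _ => ?_
    rw [mul_smul_comm]
    split_ifs with h
    · rw [consEdge_eq h, pathElem_cons, ← eq_remE hn h]
      congr 1
      have := shiftOp_remE_apply_cons hn p.1.1 w (s_eq_range h) y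
      rwa [← eq_remE hn h] at this
    · rw [S_mul_pathElem_of_ne hCK h, smul_zero]
  · intro hn e w h hw
    by_contra hp
    rw [shiftOp_apply_cons_of_ne hn hp, zero_smul] at hw
    exact hw rfl

theorem pathComb_star_shiftOp (p : (E.power n).Edge) (a b : ℕ) (y : PathSpace E) :
    pathComb hn P S (pathsIco E a b) ((star (shiftOp p) : PathOp E) y) =
      star (S p) * pathComb hn P S (pathsIco E (a + 1) (b + 1)) y := by
  classical
  rw [pathComb, pathComb, Finset.mul_sum, sum_pathsIco_consEdge p, Finset.sum_filter]
  · refine Finset.sum_congr rfl fun w _ => ?_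
    rw [mul_smul_comm]
    split_ifs with h
    · rw [consEdge_eq h]
      congr 1
      · have := star_shiftOp_remE_apply hn p.1.1 w (s_eq_range h) y
        rwa [← eq_remE hn h] at this
      · have := star_S_mul_pathElem_cons (hn := hn) hCK p.1.1 w (s_eq_range h)
        rw [← eq_remE hn h] at this
        exact this.symm
    · rw [star_shiftOp_apply_of_ne h, zero_smul]
  · intro hn e w h hw
    by_contra hp
    rw [mul_smul_comm, star_S_mul_pathElem_cons_of_ne hCK hp, smul_zero] at hw
    exact hw rfl

end Compress

end GraphAlg

end

noncomputable section
namespace GraphAlg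

open FiniteGraph Filter Topology

variable {E : FiniteGraph.{u}} {n : ℕ}

/-! ### Sums of range projections over windows of lengths -/

section RangeSum

variable {A : Type*} [NonUnitalCStarAlgebra A]

/-- The sum `∑ S_w S_w*` over the paths of length in `[a, b)`. -/
def rangeSum (hn : 0 < n) (P : (E.power n).Vertex → A) (S : (E.power n).Edge → A) (a b : ℕ) : A :=
  ∑ w ∈ pathsIco E a b, pathElem hn P S w * star (pathElem hn P S w)

variable {hn : 0 < n} {P : (E.power n).Vertex → A} {S : (E.power n).Edge → A}

theorem rangeSum_consecutive {a b c : ℕ} (hab : a ≤ b) (hbc : b ≤ c) :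
    rangeSum hn P S a b + rangeSum hn P S b c = rangeSum hn P S a c :=
  sum_pathsIco_consecutive _ hab hbc

variable (hCK : IsCKFamily (E.power n) P S)
include hCK

theorem rangeSum_succ_succ [Fintype (E.power n).Edge] (a b : ℕ) :
    rangeSum hn P S (a + 1) (b + 1) = ∑ p, S p * rangeSum hn P S a b * star (S p) := by
  classical
  -- Each conjugate is rewritten as a sum over the same long paths, with `S_p S_p*` inserted.
  -- Exchanging the sums, only the lifted last edge of each path survives.
  have h1 (p : (E.power n).Edge) : S p * rangeSum hn P S a b * star (S p) =
      ∑ w ∈ pathsIco E (a + 1) (b + 1),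
        S p * (star (S p) * pathElem hn P S w) * star (pathElem hn P S w) := by
    rw [sum_pathsIco_consEdge p, rangeSum, Finset.mul_sum, Finset.sum_mul, Finset.sum_filter]
    · refine Finset.sum_congr rfl fun w _ => ?_
      have h2 : S p * (pathElem hn P S w * star (pathElem hn P S w)) * star (S p) =
          (S p * pathElem hn P S w) * star (S p * pathElem hn P S w) := by
        rw [star_mul]; simp only [mul_assoc]
      rw [h2]
      split_ifs with h
      · have h3 := star_S_mul_pathElem_cons (hn := hn) hCK p.1.1 w (s_eq_range h)
        rw [← eq_remE hn h] at h3
        rw [consEdge_eq h, h3, pathElem_cons, ← eq_remE hn h]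
      · rw [S_mul_pathElem_of_ne hCK h, zero_mul]
    · intro hn e w h hw
      by_contra hp
      rw [star_S_mul_pathElem_cons_of_ne hCK hp, mul_zero, zero_mul] at hw
      exact hw rfl
  simp_rw [h1]
  rw [Finset.sum_comm]
  refine Finset.sum_congr rfl fun w hw => ?_
  obtain ⟨x, rfl⟩ | ⟨e, w, h, rfl⟩ := w.eq_vertex_or_cons
  · rw [mem_pathsIco, Path.length_vertex] at hw
    omega
  · rw [Finset.sum_eq_single (remE hn e w h)]
    · rw [star_S_mul_pathElem_cons hCK, pathElem_cons]
    · intro p _ hp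
      rw [star_S_mul_pathElem_cons_of_ne hCK hp, mul_zero, zero_mul]
    · simp

/-- Induction on `j`: conjugating the degree-`j` projections by `S_p` gives `S_p S_p*` exactly when
`r(p)` has degree `j + 1`. The Cuntz–Krieger relation, available at every vertex as there are no
sources, collects these. -/
theorem rangeSum_succ (hE : E.NoSources) [Fintype (E.power n).Vertex] (j : ℕ) :
    rangeSum hn P S j (j + 1) = ∑ v : (E.power n).Vertex with v.1.length = j % n, P v := by
  classical
  have := Fintype.ofFinite (E.power n).Edge
  induction j with
  | zero =>
    rw [Nat.zero_mod]
    refine Finset.sum_bij (fun w _ => remV hn w) ?_ ?_ ?_ ?_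
    · intro w hw
      rw [mem_pathsIco] at hw
      refine Finset.mem_filter.2 ⟨Finset.mem_univ _, ?_⟩
      change (w.rem n).length = 0
      rw [Path.length_rem, show w.length = 0 by omega, Nat.zero_mod]
    · intro w hw w' hw' h
      rw [mem_pathsIco] at hw hw'
      have := congrArg Subtype.val h
      simp only [remV] at this
      rwa [Path.rem_of_length_lt (by omega), Path.rem_of_length_lt (by omega)] at this
    · intro v hv
      rw [Finset.mem_filter] at hv
      exact ⟨v.1, mem_pathsIco.2 (by omega), remV_val hn v⟩
    · intro w hw
      obtain ⟨x, rfl⟩ | ⟨e, w, h, rfl⟩ := w.eq_vertex_or_cons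
      · rw [pathElem_vertex, (hCK.isStarProjection _).isSelfAdjoint.star_eq,
          (hCK.isStarProjection _).isIdempotentElem.eq]
      · rw [mem_pathsIco, Path.length_cons] at hw
        omega
  | succ j ih =>
    have h1 (p : (E.power n).Edge) :
        S p * (∑ v : (E.power n).Vertex with v.1.length = j % n, P v) * star (S p) =
          if ((E.power n).r p).1.length = (j + 1) % n then S p * star (S p) else 0 := by
      have h2 : ((E.power n).r p).1.length = (j + 1) % n ↔
          ((E.power n).s p).1.length = j % n := by
        rw [length_power_r]
        have h3 := p.1.2.2
        change (((E.power n).s p).1.length + 1) % n = _ ↔ _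
        change ((E.power n).s p).1.length < n at h3
        constructor
        · intro h
          have h4 : ((E.power n).s p).1.length ≡ j [MOD n] := Nat.ModEq.add_right_cancel' 1 h
          rw [← h4, Nat.mod_eq_of_lt h3]
        · intro h
          rw [h, Nat.mod_add_mod]
      rw [Finset.mul_sum, Finset.sum_filter, Finset.sum_eq_single ((E.power n).s p)]
      · simp_rw [h2]
        split_ifs
        · rw [hCK.S_mul_P]
        · rw [zero_mul]
      · intro v _ hv
        rw [hCK.S_mul_P_of_ne hv.symm, ite_self]
      · simp
    rw [rangeSum_succ_succ hCK, ih]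
    simp_rw [h1]
    rw [← Finset.sum_fiberwise (g := (E.power n).r), Finset.sum_filter]
    refine Finset.sum_congr rfl fun v _ => ?_
    split_ifs with hv
    · rw [← hCK.sum_filter_mul_star (power_noSources hn hE)]
      refine Finset.sum_congr rfl fun p hp => ?_
      rw [(Finset.mem_filter.1 hp).2, if_pos hv]
    · refine Finset.sum_eq_zero fun p hp => ?_
      rw [(Finset.mem_filter.1 hp).2, if_neg hv]

theorem rangeSum_block (hE : E.NoSources) [Fintype (E.power n).Vertex] (a : ℕ) {i : ℕ}
    (hi : i ≤ n) :
    rangeSum hn P S (n * a) (n * a + i) = ∑ v : (E.power n).Vertex with v.1.length < i, P v := by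
  classical
  induction i with
  | zero =>
    rw [rangeSum, Finset.sum_eq_zero, Finset.sum_eq_zero]
    · intro v hv
      simp at hv
    · intro w hw
      rw [mem_pathsIco] at hw
      omega
  | succ i ih =>
    rw [← add_assoc, ← rangeSum_consecutive (Nat.le_add_right _ i) (Nat.le_succ _),
      ih (by omega), Nat.succ_eq_add_one, rangeSum_succ hCK hE, Nat.mul_add_mod, Nat.mod_eq_of_lt hi,
      ← Finset.sum_union]
    · refine Finset.sum_congr (Finset.ext fun v => ?_) fun _ _ => rfl
      simp only [Finset.mem_union, Finset.mem_filter, Finset.mem_univ, true_and]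
      omega
    · refine Finset.disjoint_left.2 fun v hv hv' => ?_
      simp only [Finset.mem_filter, Finset.mem_univ, true_and] at hv hv'
      omega

/-- Each block of `n` consecutive lengths runs once through all residues and contributes every `P_v`
once. -/
theorem rangeSum_blocks (hE : E.NoSources) [Fintype (E.power n).Vertex] (a m : ℕ) :
    rangeSum hn P S (n * a) (n * (a + m)) = m • ∑ v : (E.power n).Vertex, P v := by
  induction m with
  | zero =>
    rw [zero_smul, rangeSum, Finset.sum_eq_zero]
    intro w hw
    rw [mem_pathsIco, add_zero] at hw
    omega
  | succ m ih =>
    rw [← add_assoc, ← rangeSum_consecutive (Nat.mul_le_mul_left n (Nat.le_add_right a m))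
      (Nat.mul_le_mul_left n (Nat.le_succ (a + m))), ih, succ_nsmul, Nat.succ_eq_add_one,
      Nat.mul_succ, rangeSum_block hCK hE _ le_rfl, Finset.filter_true_of_mem fun v _ => v.2]

theorem rangeNorm_succ_le (hE : E.NoSources) (j : ℕ) :
    rangeNorm hn P S (pathsIco E j (j + 1)) ≤ 1 := by
  have := Fintype.ofFinite (E.power n).Vertex
  change ‖rangeSum hn P S j (j + 1)‖ ≤ 1
  rw [rangeSum_succ hCK hE]
  exact (hCK.isStarProjection_sum _).norm_le

theorem rangeNorm_blocks_le (hE : E.NoSources) (a m : ℕ) :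
    rangeNorm hn P S (pathsIco E (n * a) (n * (a + m))) ≤ m := by
  have := Fintype.ofFinite (E.power n).Vertex
  change ‖rangeSum hn P S (n * a) (n * (a + m))‖ ≤ m
  rw [rangeSum_blocks hCK hE]
  refine (norm_nsmul_le).trans ?_
  exact mul_le_of_le_one_right (Nat.cast_nonneg m) (hCK.isStarProjection_sum _).norm_le

end RangeSum

/-! ## Asymptotic compressions -/

section Average

variable {A : Type*} [NonUnitalCStarAlgebra A]

/-- The normalized compression by the paths of length in `[nM, 2nM)`. -/
def avgCompress (hn : 0 < n) (P : (E.power n).Vertex → A) (S : (E.power n).Edge → A) (M : ℕ)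
    (x : PathOp E) : A :=
  (M : ℂ)⁻¹ • compress hn P S (pathsIco E (n * M) (n * (M + M)))
    (pathsIco E (n * M) (n * (M + M))) x

/-- Left multiplication by `x` is asymptotically carried to left multiplication by `b` by the
normalized compressions. -/
def AsympRel (hn : 0 < n) (P : (E.power n).Vertex → A) (S : (E.power n).Edge → A) (x : PathOp E)
    (b : A) : Prop :=
  ∀ y : PathOp E, Tendsto (fun M => avgCompress hn P S M (x * y) - b * avgCompress hn P S M y)
    atTop (𝓝 0)

variable {hn : 0 < n} {P : (E.power n).Vertex → A} {S : (E.power n).Edge → A}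

theorem avgCompress_sub (M : ℕ) (x y : PathOp E) :
    avgCompress hn P S M (x - y) = avgCompress hn P S M x - avgCompress hn P S M y := by
  rw [avgCompress, compress_sub, smul_sub]; rfl

/-- The quantifier over `y` pays off here: use the first relation at `x' * y`, then the second at
`y`, multiplied by `b`. -/
theorem AsympRel.mul {x x' : PathOp E} {b b' : A} (h : AsympRel hn P S x b)
    (h' : AsympRel hn P S x' b') : AsympRel hn P S (x * x') (b * b') := by
  intro y
  have := (h (x' * y)).add ((h' y).const_mul b)
  rw [mul_zero, add_zero] at this
  refine this.congr fun M => ?_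
  rw [mul_sub, sub_add_sub_cancel, mul_assoc, mul_assoc]

theorem AsympRel.zero : AsympRel hn P S (0 : PathOp E) (0 : A) := by
  intro y
  have h (M : ℕ) : avgCompress hn P S M (0 : PathOp E) = 0 := by
    rw [← sub_self (0 : PathOp E), avgCompress_sub, sub_self]
  simp_rw [zero_mul, h, sub_self]
  exact tendsto_const_nhds

theorem AsympRel.sub {x x' : PathOp E} {b b' : A} (h : AsympRel hn P S x b)
    (h' : AsympRel hn P S x' b') : AsympRel hn P S (x - x') (b - b') := by
  intro y
  have := (h y).sub (h' y)
  rw [sub_zero] at this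
  refine this.congr fun M => ?_
  rw [sub_mul, sub_mul, avgCompress_sub]
  abel

theorem AsympRel.add {x x' : PathOp E} {b b' : A} (h : AsympRel hn P S x b)
    (h' : AsympRel hn P S x' b') : AsympRel hn P S (x + x') (b + b') := by
  have := h.sub (AsympRel.zero.sub h')
  simpa using this

theorem pathComb_smul (I : Finset E.Path) (c : ℂ) (y : PathSpace E) :
    pathComb hn P S I (c • y) = c • pathComb hn P S I y := by
  rw [pathComb, pathComb, Finset.smul_sum]
  exact Finset.sum_congr rfl fun w _ => mul_smul c (y w) _

theorem avgCompress_smul (M : ℕ) (c : ℂ) (x : PathOp E) :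
    avgCompress hn P S M (c • x) = c • avgCompress hn P S M x := by
  rw [avgCompress, avgCompress, smul_comm c]
  congr 1
  rw [compress, compress, Finset.smul_sum]
  refine Finset.sum_congr rfl fun w _ => ?_
  rw [← smul_mul_assoc, ← pathComb_smul]; rfl

theorem AsympRel.smul {x : PathOp E} {b : A} (h : AsympRel hn P S x b) (c : ℂ) :
    AsympRel hn P S (c • x) (c • b) := by
  intro y
  have := (h y).const_smul c
  rw [smul_zero] at this
  refine this.congr fun M => ?_
  rw [smul_mul_assoc, smul_mul_assoc, avgCompress_smul, smul_sub]

variable (hCK : IsCKFamily (E.power n) P S) (hE : E.NoSources)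
include hCK hE

/-- Rows and columns each have range norm at most `M`, and the factor `M⁻¹` cancels the resulting
`M`. -/
theorem norm_avgCompress_le (M : ℕ) (x : PathOp E) : ‖avgCompress hn P S M x‖ ≤ ‖x‖ := by
  have h1 : ‖compress hn P S (pathsIco E (n * M) (n * (M + M)))
      (pathsIco E (n * M) (n * (M + M))) x‖ ≤ ‖x‖ * M := by
    have hr := rangeNorm_blocks_le (hn := hn) hCK hE M M
    refine le_of_sq_le_sq ((norm_compress_sq_le _ _ x).trans ?_) (by positivity)
    rw [mul_pow, sq (M : ℝ)]
    have : 0 ≤ rangeNorm hn P S (pathsIco E (n * M) (n * (M + M))) := norm_nonneg _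
    gcongr
  rw [avgCompress, norm_smul, norm_inv, Complex.norm_natCast]
  rcases Nat.eq_zero_or_pos M with rfl | hM
  · simp
  · rw [inv_mul_le_iff₀ (by exact_mod_cast hM)]
    exact h1.trans_eq (mul_comm _ _)

/-- Rows of a single length have range norm at most `1`, so only the columns contribute. The bound
is negligible after division by `M`. -/
theorem norm_compress_succ_le (j M : ℕ) (x : PathOp E) :
    ‖compress hn P S (pathsIco E j (j + 1)) (pathsIco E (n * M) (n * (M + M))) x‖ ≤
      ‖x‖ * √M := by
  have hr := rangeNorm_blocks_le (hn := hn) hCK hE M M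
  have hj := rangeNorm_succ_le (hn := hn) hCK hE j
  refine le_of_sq_le_sq ((norm_compress_sq_le _ _ x).trans ?_) (by positivity)
  rw [mul_pow, Real.sq_sqrt (Nat.cast_nonneg _), ← one_mul (M : ℝ)]
  have : 0 ≤ rangeNorm hn P S (pathsIco E j (j + 1)) := norm_nonneg _
  have : 0 ≤ rangeNorm hn P S (pathsIco E (n * M) (n * (M + M))) := norm_nonneg _
  gcongr

/-- The rows of the window have length at least `nM`, so a tail projection may be inserted, and its
product with the compact `K * y` tends to `0` in norm. -/
theorem AsympRel.of_isCompactOperator {K : PathOp E} (hK : IsCompactOperator K) :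
    AsympRel hn P S K 0 := by
  intro y
  simp_rw [zero_mul, sub_zero]
  have h1 : Tendsto (fun M : ℕ => n * M) atTop atTop :=
    tendsto_id.const_mul_atTop' hn
  have h2 := (tendsto_tailProj_mul (K := K * y) (hK.comp_clm y)).comp h1
  refine squeeze_zero_norm (fun M => ?_) h2
  have h3 : avgCompress hn P S M (K * y) = avgCompress hn P S M (tailProj E (n * M) * (K * y)) := by
    rw [avgCompress, avgCompress, compress_tailProj_mul le_rfl]
  rw [h3]
  exact norm_avgCompress_le hCK hE _ _

theorem tendsto_avgCompress_one [Fintype (E.power n).Vertex] :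
    Tendsto (fun M => avgCompress hn P S M 1) atTop (𝓝 (∑ v, P v)) := by
  refine tendsto_const_nhds.congr' ?_
  filter_upwards [eventually_gt_atTop 0] with M hM
  rw [avgCompress, compress_one]
  change _ = (M : ℂ)⁻¹ • rangeSum hn P S (n * M) (n * (M + M))
  rw [rangeSum_blocks hCK hE, ← Nat.cast_smul_eq_nsmul ℂ, inv_smul_smul₀]
  exact_mod_cast hM.ne'

/-- The boundary terms of a shift of the set of lengths are negligible. -/
theorem tendsto_shifted_compress (b : A) (y : PathOp E) (z : ℕ → A)
    (hz : ∀ᶠ M : ℕ in atTop, ∃ j j', z M = (M : ℂ)⁻¹ • (b *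
      (compress hn P S (pathsIco E j (j + 1)) (pathsIco E (n * M) (n * (M + M))) y -
        compress hn P S (pathsIco E j' (j' + 1)) (pathsIco E (n * M) (n * (M + M))) y))) :
    Tendsto z atTop (𝓝 0) := by
  have h0 : Tendsto (fun M : ℕ => ‖b‖ * (2 * ‖y‖) * (√M)⁻¹) atTop (𝓝 0) := by
    have h1 : Tendsto (fun M : ℕ => (√(M : ℝ))⁻¹) atTop (𝓝 0) :=
      tendsto_inv_atTop_zero.comp (Real.tendsto_sqrt_atTop.comp tendsto_natCast_atTop_atTop)
    simpa using h1.const_mul (‖b‖ * (2 * ‖y‖))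
  refine squeeze_zero_norm' ?_ h0
  filter_upwards [hz, eventually_gt_atTop 0] with M hM hM0
  obtain ⟨j, j', hj⟩ := hM
  have hM1 : (0 : ℝ) < √M := Real.sqrt_pos.2 (by exact_mod_cast hM0)
  rw [hj, norm_smul, norm_inv, Complex.norm_natCast]
  have h1 := norm_compress_succ_le (hn := hn) hCK hE j M y
  have h2 := norm_compress_succ_le (hn := hn) hCK hE j' M y
  calc _ ≤ (M : ℝ)⁻¹ * (‖b‖ * (‖y‖ * √M + ‖y‖ * √M)) := by
        gcongr
        exact (norm_mul_le _ _).trans (mul_le_mul_of_nonneg_left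
          ((norm_sub_le _ _).trans (add_le_add h1 h2)) (norm_nonneg _))
    _ = (√M * √M)⁻¹ * (‖b‖ * (‖y‖ * √M + ‖y‖ * √M)) := by
        rw [Real.mul_self_sqrt (Nat.cast_nonneg M)]
    _ = ‖b‖ * (2 * ‖y‖) * (√M)⁻¹ := by field_simp; ring

/-- Pulling out `S_p` lowers the row window by one, leaving only the rows at the two ends; for the
adjoint the window moves up instead. -/
theorem AsympRel.shiftOp (p : (E.power n).Edge) : AsympRel hn P S (shiftOp p) (S p) := by
  intro y
  refine tendsto_shifted_compress (hn := hn) hCK hE (S p) y _ ?_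
  -- For `M > 0` both ends of the window are successors, so it can be moved down.
  filter_upwards [eventually_gt_atTop 0] with M hM
  obtain ⟨a, ha⟩ := Nat.exists_eq_succ_of_ne_zero (Nat.mul_pos hn hM).ne'
  obtain ⟨b, hb⟩ := Nat.exists_eq_succ_of_ne_zero
    (Nat.mul_pos hn (Nat.add_pos_left hM M)).ne'
  have hab : a + 1 ≤ b + 1 := by
    rw [← Nat.succ_eq_add_one, ← ha, ← Nat.succ_eq_add_one, ← hb]
    exact Nat.mul_le_mul_left n (Nat.le_add_left M M)
  refine ⟨a, b, ?_⟩
  -- The column set is made opaque so that only the row window gets rewritten.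
  obtain ⟨J, hJ⟩ : ∃ J, J = pathsIco E (n * M) (n * (M + M)) := ⟨_, rfl⟩
  have hJ' : J = pathsIco E (a + 1) (b + 1) := by rw [hJ, ha, hb]
  have h1 : compress hn P S J J (GraphAlg.shiftOp p * y) =
      S p * compress hn P S (pathsIco E a b) J y := by
    rw [compress, compress, Finset.mul_sum]
    refine Finset.sum_congr rfl fun w _ => ?_
    rw [← mul_assoc, ← pathComb_shiftOp hCK, ← hJ']; rfl
  have h2 := compress_consecutive (hn := hn) (P := P) (S := S) (Nat.le_succ a) hab J y
  have h3 := compress_consecutive (hn := hn) (P := P) (S := S) (Nat.le_of_succ_le_succ hab)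
    (Nat.le_succ b) J y
  have h4 := congrArg (fun I => compress hn P S I J y) hJ'
  beta_reduce at h4
  rw [avgCompress, avgCompress, ← hJ, h1, h4, mul_smul_comm, ← smul_sub, ← mul_sub,
    sub_eq_sub_iff_add_eq_add.2 (h3.trans h2.symm)]

theorem AsympRel.star_shiftOp (p : (E.power n).Edge) :
    AsympRel hn P S (star (GraphAlg.shiftOp p)) (star (S p)) := by
  intro y
  refine tendsto_shifted_compress (hn := hn) hCK hE (star (S p)) y _ ?_
  refine Eventually.of_forall fun M => ?_
  obtain ⟨a, ha⟩ : ∃ a, a = n * M := ⟨_, rfl⟩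
  obtain ⟨b, hb⟩ : ∃ b, b = n * (M + M) := ⟨_, rfl⟩
  have hab : a ≤ b := by
    rw [ha, hb]
    exact Nat.mul_le_mul_left n (Nat.le_add_left M M)
  refine ⟨b, a, ?_⟩
  obtain ⟨J, hJ⟩ : ∃ J, J = pathsIco E (n * M) (n * (M + M)) := ⟨_, rfl⟩
  have hJ' : J = pathsIco E a b := by rw [hJ, ha, hb]
  have h1 : compress hn P S J J (star (GraphAlg.shiftOp p) * y) =
      star (S p) * compress hn P S (pathsIco E (a + 1) (b + 1)) J y := by
    rw [compress, compress, Finset.mul_sum]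
    refine Finset.sum_congr rfl fun w _ => ?_
    rw [← mul_assoc, ← pathComb_star_shiftOp hCK, ← hJ']; rfl
  have h2 := compress_consecutive (hn := hn) (P := P) (S := S) (Nat.le_succ a)
    (Nat.succ_le_succ hab) J y
  have h3 := compress_consecutive (hn := hn) (P := P) (S := S) hab (Nat.le_succ b) J y
  have h4 := congrArg (fun I => compress hn P S I J y) hJ'
  beta_reduce at h4
  have h5 := h2.trans h3.symm
  rw [add_comm, add_comm (compress hn P S (pathsIco E a b) J y)] at h5
  rw [avgCompress, avgCompress, ← hJ, h1, h4, mul_smul_comm, ← smul_sub, ← mul_sub,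
    sub_eq_sub_iff_add_eq_add.2 h5]

/-- The relation is closed under norm limits. -/
theorem AsympRel.of_approx {x : PathOp E} {b : A}
    (h : ∀ ε > 0, ∃ x' b', AsympRel hn P S x' b' ∧ ‖x - x'‖ < ε ∧ ‖b - b'‖ < ε) :
    AsympRel hn P S x b := by
  intro y
  rw [Metric.tendsto_atTop]
  intro ε hε
  have hy : 0 < 2 * (‖y‖ + 1) := by positivity
  -- Two errors of this size, each multiplied by `‖y‖`, add up to at most `ε / 2`; the `+ 1` covers
  -- `y = 0`.
  obtain ⟨x', b', h', hx, hb⟩ := h (ε / 2 / (2 * (‖y‖ + 1))) (by positivity)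
  obtain ⟨M₀, hM₀⟩ := Metric.tendsto_atTop.1 (h' y) (ε / 2) (half_pos hε)
  refine ⟨M₀, fun M hM => ?_⟩
  have h1 := hM₀ M hM
  rw [dist_zero_right] at h1 ⊢
  have h2 : avgCompress hn P S M (x * y) - b * avgCompress hn P S M y =
      avgCompress hn P S M ((x - x') * y) - (b - b') * avgCompress hn P S M y +
        (avgCompress hn P S M (x' * y) - b' * avgCompress hn P S M y) := by
    rw [sub_mul, sub_mul, avgCompress_sub]
    abel
  have h3 : ‖avgCompress hn P S M ((x - x') * y)‖ ≤ ‖x - x'‖ * ‖y‖ :=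
    (norm_avgCompress_le hCK hE _ _).trans (norm_mul_le _ _)
  have h4 : ‖(b - b') * avgCompress hn P S M y‖ ≤ ‖b - b'‖ * ‖y‖ :=
    (norm_mul_le _ _).trans (mul_le_mul_of_nonneg_left (norm_avgCompress_le hCK hE _ _)
      (norm_nonneg _))
  have h5 : (‖x - x'‖ + ‖b - b'‖) * ‖y‖ ≤ ε / 2 := by
    calc _ ≤ (ε / 2 / (2 * (‖y‖ + 1)) + ε / 2 / (2 * (‖y‖ + 1))) * (‖y‖ + 1) := by
          gcongr
          linarith
      _ = ε / 2 := by field_simp; ring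
  rw [h2]
  calc _ ≤ ‖x - x'‖ * ‖y‖ + ‖b - b'‖ * ‖y‖ + _ :=
        (norm_add_le _ _).trans (add_le_add ((norm_sub_le _ _).trans (add_le_add h3 h4)) le_rfl)
    _ < ε := by rw [← add_mul]; linarith

end Average

end GraphAlg

end

noncomputable section
namespace GraphAlg

open FiniteGraph Filter Topology

/-! ## Density of the generators of `O(F)` and of `A(n)` -/

section CKDense

variable {F : FiniteGraph.{u}}

/-- An induction principle: the image of `D` in the ambient product is a closed *-subalgebra
containing the generators, hence their closure. -/
theorem CK.mem_of_isClosed (D : NonUnitalStarSubalgebra ℂ (CK F)) (hD : IsClosed (D : Set (CK F)))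
    (hP : ∀ x, CK.P F x ∈ D) (hS : ∀ e, CK.S F e ∈ D) (b : CK F) : b ∈ D := by
  have hcl : IsClosed (CKSubalgebra F : Set (CKProduct F)) :=
    NonUnitalStarSubalgebra.isClosed_topologicalClosure _
  have hcl2 : IsClosed (Subtype.val '' (D : Set (CK F)) : Set (CKProduct F)) :=
    hcl.isClosedEmbedding_subtypeVal.isClosedMap _ hD
  have hle : CKSubalgebra F ≤
      D.map (NonUnitalStarSubalgebraClass.subtype (CKSubalgebra F)) := by
    refine NonUnitalStarSubalgebra.topologicalClosure_minimal _
      (NonUnitalStarAlgebra.adjoin_le ?_) hcl2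
    rintro _ (⟨x, rfl⟩ | ⟨e, rfl⟩)
    · exact ⟨_, hP x, rfl⟩
    · exact ⟨_, hS e, rfl⟩
  obtain ⟨c, hc, hcb⟩ := hle b.2
  rwa [← show c = b from Subtype.ext hcb]

theorem CK.hom_ext {B : Type*} [NonUnitalCStarAlgebra B] {f g : CK F →⋆ₙₐ[ℂ] B}
    (hP : ∀ x, f (CK.P F x) = g (CK.P F x)) (hS : ∀ e, f (CK.S F e) = g (CK.S F e)) : f = g := by
  have hf : Continuous f := AddMonoidHomClass.continuous_of_bound f 1 fun b => by
    simpa using NonUnitalStarAlgHom.norm_apply_le f b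
  have hg : Continuous g := AddMonoidHomClass.continuous_of_bound g 1 fun b => by
    simpa using NonUnitalStarAlgHom.norm_apply_le g b
  ext b
  exact CK.mem_of_isClosed (NonUnitalStarAlgHom.equalizer f g) (isClosed_eq hf hg) hP hS b

theorem CK.mul_sum_P [Fintype F.Vertex] (b : CK F) : b * ∑ x, CK.P F x = b := by
  have h := CK.isCKFamily F
  have hp := h.isStarProjection_sum Finset.univ
  have hPr (x : F.Vertex) : CK.P F x * ∑ x, CK.P F x = CK.P F x := by
    rw [Finset.mul_sum, Finset.sum_eq_single x]
    · exact (h.isStarProjection x).isIdempotentElem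
    · exact fun y _ hy => h.orthogonal _ _ hy.symm
    · simp
  have hPl (x : F.Vertex) : (∑ x, CK.P F x) * CK.P F x = CK.P F x := by
    have := congrArg star (hPr x)
    rwa [star_mul, hp.isSelfAdjoint.star_eq, (h.isStarProjection x).isSelfAdjoint.star_eq] at this
  -- Both one-sided identities are needed to make the set closed under the star.
  let D : NonUnitalStarSubalgebra ℂ (CK F) :=
    { carrier := {b | b * ∑ x, CK.P F x = b ∧ (∑ x, CK.P F x) * b = b}
      zero_mem' := ⟨zero_mul _, mul_zero _⟩
      add_mem' := fun ⟨h1, h2⟩ ⟨h3, h4⟩ => ⟨by rw [add_mul, h1, h3], by rw [mul_add, h2, h4]⟩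
      mul_mem' := fun ⟨h1, h2⟩ ⟨h3, h4⟩ => ⟨by rw [mul_assoc, h3], by rw [← mul_assoc, h2]⟩
      smul_mem' := fun c b ⟨h1, h2⟩ => ⟨by rw [smul_mul_assoc, h1], by rw [mul_smul_comm, h2]⟩
      star_mem' := fun {b} ⟨h1, h2⟩ => by
        have h1' := congrArg star h1
        have h2' := congrArg star h2
        rw [star_mul, hp.isSelfAdjoint.star_eq] at h1' h2'
        exact ⟨h2', h1'⟩ }
  have hD : IsClosed (D : Set (CK F)) :=
    (isClosed_eq (continuous_id.mul continuous_const) continuous_id).inter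
      (isClosed_eq (continuous_const.mul continuous_id) continuous_id)
  refine (CK.mem_of_isClosed D hD (fun x => ⟨hPr x, hPl x⟩) (fun e => ⟨?_, ?_⟩) b).1
  · rw [← h.S_mul_P, mul_assoc, hPr]
  · rw [← h.P_mul_S, ← mul_assoc, hPl]

end CKDense

variable {E : FiniteGraph.{u}} {n : ℕ}

theorem shiftAlg_mem_of_isClosed (hn : 0 < n) (D : StarSubalgebra ℂ (shiftAlg E n))
    (hD : IsClosed (D : Set (shiftAlg E n)))
    (hS : ∀ p : (E.power n).Edge, ⟨shiftOp p, shiftOp_mem p⟩ ∈ D) (a : shiftAlg E n) : a ∈ D := by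
  have hcl : IsClosed (shiftAlg E n : Set (PathOp E)) :=
    StarSubalgebra.isClosed_topologicalClosure _
  have hcl2 : IsClosed (Subtype.val '' (D : Set (shiftAlg E n)) : Set (PathOp E)) :=
    hcl.isClosedEmbedding_subtypeVal.isClosedMap _ hD
  have hle : shiftAlg E n ≤ D.map (shiftAlg E n).subtype := by
    refine StarSubalgebra.topologicalClosure_minimal (StarAlgebra.adjoin_le ?_) hcl2
    intro x hx
    have h1 : Submodule.span ℂ (Set.range (shiftOp (E := E) (n := n))) ≤
        (D.map (shiftAlg E n).subtype).toSubalgebra.toSubmodule := by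
      rw [Submodule.span_le]
      rintro _ ⟨p, rfl⟩
      exact ⟨_, hS p, rfl⟩
    exact h1 (periodicShiftOps_subset_span hn hx)
  obtain ⟨c, hc, hca⟩ := hle a.2
  rwa [← show c = a from Subtype.ext hca]

/-! ## The canonical isomorphism -/

theorem continuous_toQuot : Continuous (toQuot E n) :=
  AddMonoidHomClass.continuous_of_bound (toQuot E n) 1 fun a => by
    simpa using norm_toQuot_le a

/-- The difference of the operators is compact, hence related to `0`; the relation descends to
classes in `B(n)`. -/
theorem AsympRel.congr_toQuot {A : Type*} [NonUnitalCStarAlgebra A] {hn : 0 < n}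
    {P : (E.power n).Vertex → A} {S : (E.power n).Edge → A} (hCK : IsCKFamily (E.power n) P S)
    (hE : E.NoSources) {a a' : shiftAlg E n} {c : A} (h : AsympRel hn P S (a : PathOp E) c)
    (haa' : toQuot E n a = toQuot E n a') : AsympRel hn P S (a' : PathOp E) c := by
  have hK : IsCompactOperator ((a - a' : shiftAlg E n) : PathOp E) :=
    (mem_blockCompacts_iff (SetLike.coe_mem _)).1 (toQuot_eq_zero.1 (by
      rw [map_sub, haa', sub_self]))
  have := h.sub (AsympRel.of_isCompactOperator (hn := hn) hCK hE hK)
  rw [sub_zero] at this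
  convert this using 1
  simp

section Canonical

variable [NeZero n] {φ : CK (E.power n) →⋆ₙₐ[ℂ] quotAlg E n}

/-- Every element of `O(E(n))` is carried by the canonical homomorphism to the class of an operator
which is asymptotically carried back to it. -/
theorem exists_asympRel (hE : E.NoSources) (hE' : E.NoSinks)
    (hS : ∀ p, φ (CK.S (E.power n) p) = shiftClass p) (i : CKRep (E.power n))
    (b : CK (E.power n)) :
    ∃ a : shiftAlg E n, toQuot E n a = φ b ∧
      AsympRel (NeZero.pos n) i.P i.S (a : PathOp E) (CK.lift i b) ∧
      AsympRel (NeZero.pos n) i.P i.S (star (a : PathOp E)) (star (CK.lift i b)) := by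
  have hCK := i.isCKFamily
  -- The relation is not visibly stable under adjoints, so the one for the adjoint is carried along.
  let D : NonUnitalStarSubalgebra ℂ (CK (E.power n)) :=
    { carrier := {b | ∃ a : shiftAlg E n, toQuot E n a = φ b ∧
        AsympRel (NeZero.pos n) i.P i.S (a : PathOp E) (CK.lift i b) ∧
        AsympRel (NeZero.pos n) i.P i.S (star (a : PathOp E)) (star (CK.lift i b))}
      zero_mem' := ⟨0, by rw [map_zero, map_zero], by rw [map_zero]; exact AsympRel.zero,
        by rw [map_zero, star_zero, ZeroMemClass.coe_zero, star_zero]; exact AsympRel.zero⟩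
      add_mem' := by
        rintro b b' ⟨a, h1, h2, h3⟩ ⟨a', h1', h2', h3'⟩
        refine ⟨a + a', by rw [map_add, map_add, h1, h1'], ?_, ?_⟩
        · rw [map_add]; exact h2.add h2'
        · rw [map_add, star_add, AddMemClass.coe_add, star_add]; exact h3.add h3'
      mul_mem' := by
        rintro b b' ⟨a, h1, h2, h3⟩ ⟨a', h1', h2', h3'⟩
        refine ⟨a * a', by rw [map_mul, map_mul, h1, h1'], ?_, ?_⟩
        · rw [map_mul]; exact h2.mul h2'
        · rw [map_mul, star_mul, MulMemClass.coe_mul, star_mul]; exact h3'.mul h3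
      smul_mem' := by
        rintro c b ⟨a, h1, h2, h3⟩
        refine ⟨c • a, by rw [map_smul, map_smul, h1], ?_, ?_⟩
        · rw [map_smul]; exact h2.smul c
        · rw [map_smul, star_smul, SetLike.val_smul, star_smul]; exact h3.smul (star c)
      star_mem' := by
        rintro b ⟨a, h1, h2, h3⟩
        refine ⟨star a, by rw [map_star, map_star, h1], ?_, ?_⟩
        · rw [map_star]; exact h3
        · rw [map_star, star_star, StarMemClass.coe_star, star_star]; exact h2 }
  have hDS (p) : CK.S (E.power n) p ∈ D :=
    ⟨⟨shiftOp p, shiftOp_mem p⟩, (hS p).symm, AsympRel.shiftOp hCK hE p,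
      AsympRel.star_shiftOp hCK hE p⟩
  refine CK.mem_of_isClosed D ?_ (fun v => ?_) hDS b
  · refine isClosed_of_closure_subset fun b hb => ?_
    obtain ⟨a, ha⟩ := toQuot_surjective E n (φ b)
    -- Any lift `a` of `φ b` works. For `b'` in the set near `b`, a small lift `d` of `φ (b - b')`
    -- makes `a - d` a lift of `φ b'`, which inherits the relation and is close to `a`.
    have key (ε : ℝ) (hε : 0 < ε) : ∃ (a' : shiftAlg E n) (b' : CK (E.power n)),
        AsympRel (NeZero.pos n) i.P i.S (a' : PathOp E) (CK.lift i b') ∧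
        AsympRel (NeZero.pos n) i.P i.S (star (a' : PathOp E)) (star (CK.lift i b')) ∧
        ‖(a : PathOp E) - a'‖ < ε ∧ ‖CK.lift i b - CK.lift i b'‖ < ε := by
      obtain ⟨b', ⟨a', h1, h2, h3⟩, hb'⟩ := Metric.mem_closure_iff.1 hb (ε / 2) (half_pos hε)
      rw [dist_eq_norm] at hb'
      obtain ⟨d, hd, hdn⟩ := exists_toQuot_eq_norm_lt (φ (b - b')) (half_pos hε)
      have hφ := NonUnitalStarAlgHom.norm_apply_le φ (b - b')
      have hq : toQuot E n a' = toQuot E n (a - d) := by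
        rw [map_sub, ha, hd, map_sub, sub_sub_cancel, h1]
      refine ⟨a - d, b', h2.congr_toQuot hCK hE hq, ?_, ?_, ?_⟩
      · refine AsympRel.congr_toQuot (a := star a') (a' := star (a - d)) hCK hE h3 ?_
        rw [map_star, map_star, hq]
      · have : (a : PathOp E) - ((a - d : shiftAlg E n) : PathOp E) = d := by simp
        rw [this]
        change ‖d‖ < ε
        linarith
      · rw [← map_sub]
        exact (NonUnitalStarAlgHom.norm_apply_le (CK.lift i) _).trans_lt (by linarith)
    refine ⟨a, ha, AsympRel.of_approx hCK hE fun ε hε => ?_,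
      AsympRel.of_approx hCK hE fun ε hε => ?_⟩
    · obtain ⟨a', b', h1, -, h2, h3⟩ := key ε hε
      exact ⟨_, _, h1, h2, h3⟩
    · obtain ⟨a', b', -, h1, h2, h3⟩ := key ε hε
      refine ⟨_, _, h1, ?_, ?_⟩
      · rwa [← star_sub, norm_star]
      · rwa [← star_sub, norm_star]
  · obtain ⟨p, rfl⟩ := power_noSinks (n := n) hE' v
    rw [← (CK.isCKFamily _).star_mul_self]
    exact mul_mem (star_mem (hDS p)) (hDS p)

/-- When `φ b = 0`, the zero operator is related to `b`. Taking `y = 1`, `b` times the averages of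
`1` tends to `0`; these averages tend to the unit. Testing in every family suffices. -/
theorem canonicalHom_injective (hE : E.NoSources) (hE' : E.NoSinks)
    (hS : ∀ p, φ (CK.S (E.power n) p) = shiftClass p) : Function.Injective φ := by
  have := Fintype.ofFinite (E.power n).Vertex
  rw [injective_iff_map_eq_zero]
  intro b hb
  refine CK.ext_eval fun i => ?_
  obtain ⟨a, ha, h, -⟩ := exists_asympRel hE hE' hS i b
  have h0 : AsympRel (NeZero.pos n) i.P i.S ((0 : shiftAlg E n) : PathOp E) (CK.lift i b) :=
    h.congr_toQuot i.isCKFamily hE (by rw [ha, hb, map_zero])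
  have h1 := h0 1
  have h2 := (AsympRel.zero (hn := NeZero.pos n) (P := i.P) (S := i.S)) 1
  have h3 := (tendsto_avgCompress_one (hn := NeZero.pos n) i.isCKFamily hE).const_mul
    (CK.lift i b)
  have h4 := (h2.sub h1).congr' (f₂ := fun M => CK.lift i b *
      avgCompress (NeZero.pos n) i.P i.S M 1) (Eventually.of_forall fun M => by
    simp)
  rw [sub_zero] at h4
  calc CK.lift i b = CK.lift i (b * ∑ v, CK.P _ v) := by rw [CK.mul_sum_P]
    _ = CK.lift i b * ∑ v, i.P v := by rw [map_mul, map_sum]; rfl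
    _ = 0 := tendsto_nhds_unique h3 h4
    _ = CK.lift i 0 := (map_zero _).symm

/-- Injective *-homomorphisms are isometric, so the range is closed and only generators need
checking. -/
theorem canonicalHom_surjective (hφ : Function.Injective φ) (hE' : E.NoSinks)
    (hP : ∀ v, φ (CK.P (E.power n) v) = remClass (NeZero.pos n) hE' v)
    (hS : ∀ p, φ (CK.S (E.power n) p) = shiftClass p) : Function.Surjective φ := by
  have hiso := NonUnitalStarAlgHom.isometry φ hφ
  have hcl : IsClosed (Set.range φ) := hiso.isClosedEmbedding.isClosed_range
  -- `A(n)` is generated as a unital algebra, so the unit must be reached too; it is the sum of the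
  -- classes of the `Q_v`.
  have h1 : (1 : quotAlg E n) ∈ Set.range φ := by
    have := Fintype.ofFinite (E.power n).Vertex
    refine ⟨∑ v, CK.P (E.power n) v, ?_⟩
    rw [map_sum]
    simp_rw [hP, remClass]
    rw [← map_sum, ← map_one (toQuot E n)]
    refine congrArg _ (Subtype.ext ?_)
    rw [AddSubmonoidClass.coe_finsetSum]
    exact sum_remProj (NeZero.pos n)
  let D : StarSubalgebra ℂ (shiftAlg E n) :=
    { carrier := {a | toQuot E n a ∈ Set.range φ}
      mul_mem' := by
        rintro a a' ⟨b, hb⟩ ⟨b', hb'⟩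
        exact ⟨b * b', by rw [map_mul, map_mul, hb, hb']⟩
      add_mem' := by
        rintro a a' ⟨b, hb⟩ ⟨b', hb'⟩
        exact ⟨b + b', by rw [map_add, map_add, hb, hb']⟩
      algebraMap_mem' := by
        intro c
        obtain ⟨b, hb⟩ := h1
        exact ⟨c • b, by rw [map_smul, hb, Algebra.algebraMap_eq_smul_one, map_smul, map_one]⟩
      star_mem' := by
        rintro a ⟨b, hb⟩
        exact ⟨star b, by rw [map_star, map_star, hb]⟩ }
  have hD : IsClosed (D : Set (shiftAlg E n)) := hcl.preimage continuous_toQuot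
  intro x
  obtain ⟨a, rfl⟩ := toQuot_surjective E n x
  exact shiftAlg_mem_of_isClosed (NeZero.pos n) D hD (fun p => ⟨_, hS p⟩) a

end Canonical

end GraphAlg

end

/-! ### Uniqueness of the canonical isomorphism and the connecting map -/

noncomputable section

namespace GraphAlg

open FiniteGraph Filter Topology

variable {E : FiniteGraph.{u}} {n N : ℕ}

theorem IsCanonicalIso.apply_P {π : CK (E.power n) ≃⋆ₐ[ℂ] quotAlg E n} (h : IsCanonicalIso E n π)
    (hn : 0 < n) (hE : E.NoSinks) (v : (E.power n).Vertex) :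
    π (CK.P (E.power n) v) = remClass hn hE v := by
  obtain ⟨Q, hQ, hπ⟩ := h.1 v
  rw [hπ]
  exact congrArg (toQuot E n) (Subtype.ext hQ.eq_remProj)

theorem IsCanonicalIso.apply_S {π : CK (E.power n) ≃⋆ₐ[ℂ] quotAlg E n} (h : IsCanonicalIso E n π)
    (p : (E.power n).Edge) : π (CK.S (E.power n) p) = shiftClass p := by
  obtain ⟨T, hT, hπ⟩ := h.2 p
  rw [hπ]
  exact congrArg (toQuot E n) (Subtype.ext hT.eq_shiftOp)

theorem existsUnique_isCanonicalIso (hn : 0 < n) (hE : E.NoSources) (hE' : E.NoSinks) :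
    ∃! π : CK (E.power n) ≃⋆ₐ[ℂ] quotAlg E n, IsCanonicalIso E n π := by
  have : NeZero n := ⟨hn.ne'⟩
  obtain ⟨φ, hP, hS⟩ := exists_canonicalHom (n := n) hE'
  have hinj := canonicalHom_injective hE hE' hS
  refine ⟨StarAlgEquiv.ofBijective φ ⟨hinj, canonicalHom_surjective hinj hE' hP hS⟩, ⟨fun v => ?_,
    fun p => ?_⟩, fun π hπ => ?_⟩
  · exact ⟨⟨remProj v, remProj_mem hn hE' v⟩, isRemProj_remProj v, hP v⟩
  · exact ⟨⟨shiftOp p, shiftOp_mem p⟩, isShiftOp_shiftOp p, hS p⟩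
  · have h : (π : CK (E.power n) →⋆ₙₐ[ℂ] quotAlg E n) = φ :=
      CK.hom_ext (fun v => (hπ.apply_P hn hE' v).trans (hP v).symm)
        fun p => (hπ.apply_S p).trans (hS p).symm
    ext b
    exact DFunLike.congr_fun h b

/-- Since `w(n) = (w(N))(n)`, the paths with remainder `v` modulo `n` are partitioned by their
remainders modulo `N`. -/
theorem remProj_eq_sum (hn : 0 < n) (hN : 0 < N) (h : n ∣ N) [Fintype (E.power N).Vertex]
    [DecidableEq (E.power n).Vertex] (v : (E.power n).Vertex) :
    remProj v = ∑ u : (E.power N).Vertex with remVertex E hn N u = v, remProj u := by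
  refine pathOp_ext fun w => ?_
  have hw (u : (E.power N).Vertex) (hu : w.rem N = u.1) : w.rem n = (remVertex E hn N u).1 := by
    change _ = u.1.rem n
    rw [← hu, Path.rem_rem h]
  rw [_root_.sum_apply]
  by_cases hv : w.rem n = v.1
  · rw [remProj_ξ_of_eq hv, Finset.sum_eq_single (remV hN w)]
    · rw [remProj_ξ_of_eq rfl]
    · exact fun u _ hu => remProj_ξ_of_ne fun h' => hu (Subtype.ext h'.symm)
    · exact fun hu => (hu (Finset.mem_filter.2 ⟨Finset.mem_univ _,
        Subtype.ext ((hw (remV hN w) rfl).symm.trans hv)⟩)).elim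
  · rw [remProj_ξ_of_ne hv]
    refine (Finset.sum_eq_zero fun u hu => remProj_ξ_of_ne fun h' => hv ?_).symm
    rw [hw u h', (Finset.mem_filter.1 hu).2]

theorem shiftOp_eq_sum (hn : 0 < n) (hN : 0 < N) (h : n ∣ N) [Fintype (E.power N).Edge]
    [DecidableEq (E.power n).Edge] (p : (E.power n).Edge) :
    shiftOp p = ∑ q : (E.power N).Edge with remEdge E hn N q = p, shiftOp q := by
  refine pathOp_ext fun w => ?_
  have hrem (e : E.Edge) (hw : E.s e = w.range) :
      remEdge E hn N (remE hN e w hw) = remE hn e w hw :=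
    power_ext rfl (Path.rem_rem h w)
  rw [_root_.sum_apply]
  obtain ⟨e, hw, rfl⟩ | hv := eq_remE_or_rem_ne hn p w
  · rw [shiftOp_remE_ξ, Finset.sum_eq_single (remE hN e w hw)]
    · rw [shiftOp_remE_ξ]
    · intro q hq hne
      refine shiftOp_ξ_of_ne fun h' => hne (power_ext ?_ h'.symm)
      exact congrArg (fun q : (E.power n).Edge => q.1.1) (Finset.mem_filter.1 hq).2
    · exact fun hq => (hq (by simpa using hrem e hw)).elim
  · rw [shiftOp_ξ_of_ne hv]
    refine (Finset.sum_eq_zero fun q hq => shiftOp_ξ_of_ne fun h' => hv ?_).symm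
    rw [← (Finset.mem_filter.1 hq).2]
    change _ = q.1.2.1.rem n
    rw [← h', Path.rem_rem h]

/-- Both ideals are cut out by the same condition on operators, so passing to the larger algebra
kills nothing new. -/
theorem quotIncl_injective (h : n ∣ N) : Function.Injective (quotIncl E h) := by
  intro x y hxy
  obtain ⟨a, rfl⟩ := toQuot_surjective E n x
  obtain ⟨b, rfl⟩ := toQuot_surjective E n y
  rw [quotIncl_toQuot, quotIncl_toQuot, ← sub_eq_zero, ← map_sub, ← map_sub] at hxy
  have hc : (shiftIncl E h (a - b) : PathOp E) ∈ blockCompacts E := toQuot_eq_zero.1 hxy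
  rw [← sub_eq_zero, ← map_sub]
  exact toQuot_eq_zero.2 hc

/-- On generators this reduces to identities between operators in `A(N)`. -/
theorem isInducedHom_connecting (hn : 0 < n) (hN : 0 < N) (h : n ∣ N) (hE : E.NoSinks)
    {πn : CK (E.power n) ≃⋆ₐ[ℂ] quotAlg E n} {πN : CK (E.power N) ≃⋆ₐ[ℂ] quotAlg E N}
    (hπn : IsCanonicalIso E n πn) (hπN : IsCanonicalIso E N πN) :
    IsInducedHom (remVertex E hn N) (remEdge E hn N) (connecting E h πn πN) := by
  classical
  have := Fintype.ofFinite (E.power N).Vertex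
  have := Fintype.ofFinite (E.power N).Edge
  refine ⟨fun v => ?_, fun p => ?_⟩
  · rw [finsum_subtype_eq_sum_filter (fun u => remVertex E hn N u = v) fun u => CK.P (E.power N) u]
    change πN.symm (quotIncl E h (πn _)) = _
    rw [hπn.apply_P hn hE, StarAlgEquiv.symm_apply_eq, map_sum]
    simp_rw [hπN.apply_P hN hE, remClass]
    rw [quotIncl_toQuot, ← map_sum]
    refine congrArg (toQuot E N) (Subtype.ext ?_)
    rw [AddSubmonoidClass.coe_finsetSum]
    exact remProj_eq_sum hn hN h v
  · rw [finsum_subtype_eq_sum_filter (fun q => remEdge E hn N q = p) fun q => CK.S (E.power N) q]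
    change πN.symm (quotIncl E h (πn _)) = _
    rw [hπn.apply_S, StarAlgEquiv.symm_apply_eq, map_sum]
    simp_rw [hπN.apply_S, shiftClass]
    rw [quotIncl_toQuot, ← map_sum]
    refine congrArg (toQuot E N) (Subtype.ext ?_)
    rw [AddSubmonoidClass.coe_finsetSum]
    exact shiftOp_eq_sum hn hN h p

theorem connecting_injective (h : n ∣ N) (πn : CK (E.power n) ≃⋆ₐ[ℂ] quotAlg E n)
    (πN : CK (E.power N) ≃⋆ₐ[ℂ] quotAlg E N) : Function.Injective (connecting E h πn πN) :=
  πN.symm.injective.comp ((quotIncl_injective h).comp πn.injective)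

theorem IsInducedHom.unique {F G : FiniteGraph.{u}} {m0 : F.Vertex → G.Vertex}
    {m1 : F.Edge → G.Edge} {μ ν : CK G →⋆ₙₐ[ℂ] CK F} (hμ : IsInducedHom m0 m1 μ)
    (hν : IsInducedHom m0 m1 ν) : μ = ν :=
  CK.hom_ext (fun v => (hμ.1 v).trans (hν.1 v).symm) fun e => (hμ.2 e).trans (hν.2 e).symm

end GraphAlg

end

theorem mainTheorem12 (E : FiniteGraph.{u}) (hsrc : E.NoSources) (hsink : E.NoSinks)
    (n k : ℕ) (hn : 0 < n) (hk : 0 < k) :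
    IsRegularFactorMap (E.power (n * k)) (E.power n)
      (remVertex E hn (n * k)) (remEdge E hn (n * k)) ∧
    (∃! πn : CK (E.power n) ≃⋆ₐ[ℂ] quotAlg E n, IsCanonicalIso E n πn) ∧
    (∃! πnk : CK (E.power (n * k)) ≃⋆ₐ[ℂ] quotAlg E (n * k), IsCanonicalIso E (n * k) πnk) ∧
    (∃! μ : CK (E.power n) →⋆ₙₐ[ℂ] CK (E.power (n * k)),
      IsInducedHom (remVertex E hn (n * k)) (remEdge E hn (n * k)) μ) ∧
    ∀ (πn : CK (E.power n) ≃⋆ₐ[ℂ] quotAlg E n)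
      (πnk : CK (E.power (n * k)) ≃⋆ₐ[ℂ] quotAlg E (n * k))
      (μ : CK (E.power n) →⋆ₙₐ[ℂ] CK (E.power (n * k))),
      IsCanonicalIso E n πn → IsCanonicalIso E (n * k) πnk →
      IsInducedHom (remVertex E hn (n * k)) (remEdge E hn (n * k)) μ →
      Function.Injective (connecting E (Nat.dvd_mul_right n k) πn πnk) ∧
      connecting E (Nat.dvd_mul_right n k) πn πnk = μ := by
  have hnk : 0 < n * k := Nat.mul_pos hn hk
  have h1 := existsUnique_isCanonicalIso hn hsrc hsink
  have h2 := existsUnique_isCanonicalIso hnk hsrc hsink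
  refine ⟨isRegularFactorMap_rem hsrc hn (Nat.dvd_mul_right n k) hnk, h1, h2, ?_, ?_⟩
  -- The connecting map of the canonical isomorphisms itself witnesses that `μ_m` exists, so no
  -- Cuntz–Krieger relations for the fibre sums have to be checked.
  · obtain ⟨π, hπ, -⟩ := h1
    obtain ⟨π', hπ', -⟩ := h2
    exact ⟨_, isInducedHom_connecting hn hnk (Nat.dvd_mul_right n k) hsink hπ hπ',
      fun μ hμ => hμ.unique (isInducedHom_connecting hn hnk _ hsink hπ hπ')⟩
  · intro πn πnk μ hπn hπnk hμ
    exact ⟨connecting_injective _ _ _,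
      (isInducedHom_connecting hn hnk _ hsink hπn hπnk).unique hμ⟩
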